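/- Let $\mathcal C=(\mathcal C,\otimes,c,[-,-])$ be a closed symmetric monoidal category whose underlying category has all finite limits and all finite colimits, and let $\mathfrak b=(b,u_b,m_b)$ and $\mathfrak b'=(b',u_{b'},m_{b'})$ be monoids in $\mathcal C$. Let $\mathrm{Mod}_{\mathfrak b}$ be the $\mathcal C$-enriched category of right $\mathfrak b$-modules, in which the hom-object from $(z,\gamma_z)$ to $(\tilde z,\gamma_{\tilde z})$ is the equalizer of the two morphisms $[z,\tilde z]\rightrightarrows[z\otimes b,\tilde z]$ given by $\gamma_z$ and $\gamma_{\tilde z}$; let $b_{\mathfrak b}=(b,m_b)$ be the regular right module, and define $\mathrm{Mod}_{\mathfrak b'}$ likewise. Let ${}_{\mathfrak b}\mathrm{Mod}_{\mathfrak b'}$ be the (ordinary) category of $(\mathfrak b,\mathfrak b')$-bimodules in $\mathcal C$. Let $\mathcal C\text{-}\mathrm{Funct}_{\mathrm{cocon}}(\mathrm{Mod}_{\mathfrak b},\mathrm{Mod}_{\mathfrak b'})$ be the category of cocontinuous $\mathcal C$-enriched functors $\mathrm{Mod}_{\mathfrak b}\to\mathrm{Mod}_{\mathfrak b'}$ and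 $\mathcal C$-enriched natural transformations, where a $\mathcal C$-enriched functor is cocontinuous if it preserves all weighted colimits existing in its source that are indexed by small $\mathcal C$-categories (the notion of smallness being given by any fixed universe). Then there is an adjoint equivalence of categories $$ {}_{\mathfrak b}\mathrm{Mod}_{\mathfrak b'}\;\rightleftarrows\;\mathcal C\text{-}\mathrm{Funct}_{\mathrm{cocon}}(\mathrm{Mod}_{\mathfrak b},\mathrm{Mod}_{\mathfrak b'}). $$ Its left adjoint sends a bimodule $x$ to the $\mathcal C$-enriched functor $-\otimes_{\mathfrak b}x$, where $z\otimes_{\mathfrak b}x$ is the coequalizer of the two morphisms $z\otimes b\otimes x\rightrightarrows z\otimes x$ given by the actions of $\mathfrak b$ on $z$ and on $x$. Its right adjoint is evaluation at $b_{\mathfrak b}$: it sends $\mathcal F$ to the right $\mathfrak b'$-module $\mathcal F(b_{\mathfrak b})$ with the left action of $\mathfrak b$ that corresponds to the composite $b\to\mathrm{Mod}_{\mathfrak b}(b_{\mathfrak b},b_{\mathfrak b})\to\mathrm{Mod}_{\mathfrak b'}(\mathcal F(b_{\mathfrak b}),\mathcal F(b_{\mathfrak b}))$ of left multiplication and the action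 of $\mathcal F$ on hom-objects, and it sends a transformation $\xi$ to its component $\xi_{b_{\mathfrak b}}$. -/

import Mathlib

open CategoryTheory MonoidalCategory Limits
open scoped MonoidalClosed

universe w v u u₁ u₂

namespace EnrichedEW

section Swap

variable {C : Type u} [Category.{v} C] [MonoidalCategory C] [SymmetricCategory C]

/-- The symmetry `(m ⊗ b) ⊗ a ⟶ (m ⊗ a) ⊗ b` exchanging the last two factors. -/
def swap (M B A : C) : (M ⊗ B) ⊗ A ⟶ (M ⊗ A) ⊗ B :=
  (α_ M B A).hom ≫ M ◁ (β_ B A).hom ≫ (α_ M A B).inv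

theorem swap_nat_left {M N : C} (f : M ⟶ N) (B A : C) :
    f ▷ B ▷ A ≫ swap N B A = swap M B A ≫ f ▷ A ▷ B := by
  simp only [swap]
  rw [associator_naturality_left_assoc, ← whisker_exchange_assoc, associator_inv_naturality_left]
  simp

theorem swap_nat_mid (M : C) {B B' : C} (f : B ⟶ B') (A : C) :
    (M ◁ f) ▷ A ≫ swap M B' A = swap M B A ≫ (M ⊗ A) ◁ f := by
  simp only [swap]
  rw [associator_naturality_middle_assoc, ← whiskerLeft_comp_assoc,
    BraidedCategory.braiding_naturality_left, whiskerLeft_comp_assoc,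
    associator_inv_naturality_right]
  simp

theorem swap_nat_right (M B : C) {A A' : C} (f : A ⟶ A') :
    (M ⊗ B) ◁ f ≫ swap M B A' = swap M B A ≫ (M ◁ f) ▷ B := by
  simp only [swap]
  rw [associator_naturality_right_assoc, ← whiskerLeft_comp_assoc,
    BraidedCategory.braiding_naturality_right, whiskerLeft_comp_assoc,
    associator_inv_naturality_middle]
  simp

theorem swap_unit (M B : C) : swap M B (𝟙_ C) ≫ (ρ_ M).hom ▷ B = (ρ_ (M ⊗ B)).hom := by
  simp [swap]

theorem swap_tensor_right (M B A A' : C) :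
    (α_ (M ⊗ B) A A').inv ≫ swap M B A ▷ A' ≫ swap (M ⊗ A) B A' =
      swap M B (A ⊗ A') ≫ (α_ M A A').inv ▷ B := by
  simp [swap, BraidedCategory.braiding_tensor_right_hom]

theorem swap_tensor_mid (M B B' A : C) :
    swap (M ⊗ B) B' A ≫ swap M B A ▷ B' ≫ (α_ (M ⊗ A) B B').hom =
      (α_ M B B').hom ▷ A ≫ swap M (B ⊗ B') A := by
  simp [swap, BraidedCategory.braiding_tensor_left_hom]

theorem braiding_swap (M B A : C) : (α_ A M B).hom ≫ (β_ A (M ⊗ B)).hom ≫ swap M B A =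
    (β_ A M).hom ▷ B := by
  have h : M ◁ (β_ A B).hom ≫ M ◁ (β_ B A).hom = 𝟙 _ := by
    rw [← MonoidalCategory.whiskerLeft_comp, SymmetricCategory.symmetry,
      MonoidalCategory.whiskerLeft_id]
  simp [swap, BraidedCategory.braiding_tensor_right_hom, reassoc_of% h]

theorem braiding_three (M A B : C) : (β_ (A ⊗ B) M).hom ≫ M ◁ (β_ A B).hom ≫ (α_ M B A).inv =
    (α_ A B M).hom ≫ A ◁ (β_ B M).hom ≫ (β_ A (M ⊗ B)).hom := by
  simp [BraidedCategory.braiding_tensor_left_hom, BraidedCategory.braiding_tensor_right_hom]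

theorem braiding_three' (M A B : C) :
    M ◁ (β_ A B).hom ≫ (α_ M B A).inv ≫ (β_ M B).hom ▷ A ≫ (β_ (B ⊗ M) A).hom =
      (β_ M (A ⊗ B)).hom ≫ (α_ A B M).hom := by
  have h₁ : (α_ M B A).inv ≫ (β_ M B).hom ▷ A ≫ (β_ (B ⊗ M) A).hom =
      (β_ M (B ⊗ A)).hom ≫ (β_ B A).hom ▷ M ≫ (α_ A B M).hom := by
    simp [BraidedCategory.braiding_tensor_left_hom, BraidedCategory.braiding_tensor_right_hom]
  rw [h₁, BraidedCategory.braiding_naturality_right_assoc, ← comp_whiskerRight_assoc,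
    SymmetricCategory.symmetry, id_whiskerRight, Category.id_comp]

end Swap

section Generic

variable {C : Type u} [Category.{v} C] [MonoidalCategory C]

section Star

variable {D : Type u₁} [EnrichedCategory C D]

/-- Composition in a `C`-enriched category on generalized elements of the hom-objects. -/
def star {X Y Z : D} {A B : C} (f : A ⟶ (X ⟶[C] Y)) (g : B ⟶ (Y ⟶[C] Z)) :
    A ⊗ B ⟶ (X ⟶[C] Z) :=
  (f ⊗ₘ g) ≫ eComp C X Y Z

theorem star_assoc {X Y Z T : D} {A B A' : C} (f : A ⟶ (X ⟶[C] Y)) (g : B ⟶ (Y ⟶[C] Z))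
    (h : A' ⟶ (Z ⟶[C] T)) : star (star f g) h = (α_ A B A').hom ≫ star f (star g h) := by
  have key := e_assoc C X Y Z T
  simp only [star]
  have h₁ : ((f ⊗ₘ g) ≫ eComp C X Y Z ⊗ₘ h) = ((f ⊗ₘ g) ⊗ₘ h) ≫ eComp C X Y Z ▷ _ := by
    rw [← tensorHom_id, tensorHom_comp_tensorHom, Category.comp_id]
  have h₂ : (f ⊗ₘ (g ⊗ₘ h) ≫ eComp C Y Z T) = (f ⊗ₘ (g ⊗ₘ h)) ≫ _ ◁ eComp C Y Z T := by
    rw [← id_tensorHom, tensorHom_comp_tensorHom, Category.comp_id]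
  rw [h₁, h₂, Category.assoc, Category.assoc, ← key, associator_inv_naturality_assoc,
    Iso.hom_inv_id_assoc]

theorem star_pre {X Y Z : D} {A B A' B' : C} (p : A' ⟶ A) (q : B' ⟶ B) (f : A ⟶ (X ⟶[C] Y))
    (g : B ⟶ (Y ⟶[C] Z)) : star (p ≫ f) (q ≫ g) = (p ⊗ₘ q) ≫ star f g := by
  simp [star]

theorem star_pre_left {X Y Z : D} {A B A' : C} (p : A' ⟶ A) (f : A ⟶ (X ⟶[C] Y))
    (g : B ⟶ (Y ⟶[C] Z)) : star (p ≫ f) g = p ▷ B ≫ star f g := by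
  simpa using star_pre p (𝟙 B) f g

theorem star_pre_right {X Y Z : D} {A B B' : C} (q : B' ⟶ B) (f : A ⟶ (X ⟶[C] Y))
    (g : B ⟶ (Y ⟶[C] Z)) : star f (q ≫ g) = A ◁ q ≫ star f g := by
  simpa using star_pre (𝟙 A) q f g

theorem star_eId {X Y : D} {A : C} (f : A ⟶ (X ⟶[C] Y)) :
    star f (eId C Y) = (ρ_ A).hom ≫ f := by
  rw [star, MonoidalCategory.tensorHom_def, Category.assoc, ← cancel_epi (ρ_ A).inv,
    ← rightUnitor_inv_naturality_assoc]
  simp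

theorem eId_star {X Y : D} {A : C} (f : A ⟶ (X ⟶[C] Y)) :
    star (eId C X) f = (λ_ A).hom ≫ f := by
  rw [star, MonoidalCategory.tensorHom_def', Category.assoc, ← cancel_epi (λ_ A).inv,
    ← leftUnitor_inv_naturality_assoc]
  simp

theorem star_map {E : Type u₂} [EnrichedCategory C E] (F : EnrichedFunctor C D E) {X Y Z : D}
    {A B : C} (f : A ⟶ (X ⟶[C] Y)) (g : B ⟶ (Y ⟶[C] Z)) :
    star f g ≫ F.map X Z = star (f ≫ F.map X Y) (g ≫ F.map Y Z) := by
  simp [star]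

end Star

section Nat

variable {D : Type u₁} [EnrichedCategory C D] {E : Type u₂} [EnrichedCategory C E]

/-- A `C`-enriched natural transformation between `C`-enriched functors. The naturality condition is
an equality of morphisms out of the hom-objects. It is in general stronger than the naturality of
the underlying transformation of the underlying ordinary functors (which is what
`CategoryTheory.EnrichedNatTrans` records). -/
@[ext]
structure EnrichedTrans (F G : EnrichedFunctor C D E) where
  /-- The components, which are morphisms of the underlying category of `E`. -/
  app : ∀ X : D, 𝟙_ C ⟶ (F.obj X ⟶[C] G.obj X)
  naturality : ∀ X Y : D,
    (λ_ (X ⟶[C] Y)).inv ≫ (app X ⊗ₘ G.map X Y) ≫ eComp C (F.obj X) (G.obj X) (G.obj Y) =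
      (ρ_ (X ⟶[C] Y)).inv ≫ (F.map X Y ⊗ₘ app Y) ≫ eComp C (F.obj X) (F.obj Y) (G.obj Y)

/-- The identity transformation. -/
def EnrichedTrans.id (F : EnrichedFunctor C D E) : EnrichedTrans F F where
  app X := eId C (F.obj X)
  naturality X Y := by
    have h₁ := eId_star (F.map X Y)
    have h₂ := star_eId (F.map X Y)
    simp only [star] at h₁ h₂
    rw [h₁, h₂]
    simp

/-- Vertical composition of transformations. -/
def EnrichedTrans.comp {F G H : EnrichedFunctor C D E} (ξ : EnrichedTrans F G)
    (ζ : EnrichedTrans G H) : EnrichedTrans F H where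
  app X := (λ_ (𝟙_ C)).inv ≫ (ξ.app X ⊗ₘ ζ.app X) ≫ eComp C (F.obj X) (G.obj X) (H.obj X)
  naturality X Y := by
    have h₁ : ∀ X Y, star (ξ.app X) (G.map X Y) =
        (λ_ _).hom ≫ (ρ_ _).inv ≫ star (F.map X Y) (ξ.app Y) := fun X Y => by
      rw [← cancel_epi (λ_ _).inv]; simpa [star] using ξ.naturality X Y
    have h₂ : ∀ X Y, star (ζ.app X) (H.map X Y) =
        (λ_ _).hom ≫ (ρ_ _).inv ≫ star (G.map X Y) (ζ.app Y) := fun X Y => by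
      rw [← cancel_epi (λ_ _).inv]; simpa [star] using ζ.naturality X Y
    change (λ_ _).inv ≫ star ((λ_ _).inv ≫ star (ξ.app X) (ζ.app X)) (H.map X Y) =
      (ρ_ _).inv ≫ star (F.map X Y) ((λ_ _).inv ≫ star (ξ.app Y) (ζ.app Y))
    have h₃ : star (ξ.app X) (star (G.map X Y) (ζ.app Y)) =
        (α_ _ _ _).inv ≫ star (star (ξ.app X) (G.map X Y)) (ζ.app Y) := by
      rw [star_assoc, Iso.inv_hom_id_assoc]
    rw [star_pre_left, star_assoc, h₂, ← Category.assoc (λ_ _).hom, star_pre_right, h₃, h₁,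
      ← Category.assoc (λ_ _).hom, star_pre_left, star_assoc, star_pre_right]
    monoidal

end Nat

variable (C) in
/-- The type of `C`-enriched functors `D ⥤ E`, wrapped in a structure in order to carry the category
structure whose morphisms are the `C`-enriched natural transformations. -/
structure EnrichedFunct (D : Type u₁) [EnrichedCategory C D] (E : Type u₂)
    [EnrichedCategory C E] where
  /-- The enriched functor. -/
  functor : EnrichedFunctor C D E

/-- The category `C-Funct(D, E)` of `C`-enriched functors and `C`-enriched natural
transformations. -/
instance EnrichedFunct.category (D : Type u₁) [EnrichedCategory C D] (E : Type u₂)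
    [EnrichedCategory C E] : Category (EnrichedFunct C D E) where
  Hom F G := EnrichedTrans F.functor G.functor
  id F := EnrichedTrans.id F.functor
  comp ξ ζ := EnrichedTrans.comp ξ ζ
  id_comp ξ := by
    refine EnrichedTrans.ext (funext fun X => ?_)
    exact (congrArg _ (eId_star (ξ.app X))).trans (Iso.inv_hom_id_assoc _ _)
  comp_id ξ := by
    refine EnrichedTrans.ext (funext fun X => ?_)
    change (λ_ _).inv ≫ star (ξ.app X) (eId C _) = ξ.app X
    rw [star_eId, unitors_inv_equal, Iso.inv_hom_id_assoc]
  assoc ξ ζ χ := by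
    refine EnrichedTrans.ext (funext fun X => ?_)
    change (λ_ _).inv ≫ star ((λ_ _).inv ≫ star (ξ.app X) (ζ.app X)) (χ.app X) =
      (λ_ _).inv ≫ star (ξ.app X) ((λ_ _).inv ≫ star (ζ.app X) (χ.app X))
    rw [star_pre_left, star_pre_right, star_assoc, ← Category.assoc ((λ_ (𝟙_ C)).inv ▷ _)]
    congr 2
    monoidal

end Generic

section Cocontinuity

variable {C : Type u} [Category.{v} C] [MonoidalCategory C] [SymmetricCategory C]
  [MonoidalClosed C]
variable {J : Type w} [EnrichedCategory C J] {D : Type u₁} [EnrichedCategory C D]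
  {E : Type u₂} [EnrichedCategory C E]

/-- The contravariant action `J(i, j) ⊗ W j ⟶ W i` of a presheaf `W : Jᵒᵖ ⥤ C`. -/
def weightAct (W : EnrichedFunctor C Jᵒᵖ C) (i j : J) :
    (i ⟶[C] j) ⊗ W.obj (Opposite.op j) ⟶ W.obj (Opposite.op i) :=
  (β_ _ _).hom ≫ MonoidalClosed.uncurry (W.map (Opposite.op j) (Opposite.op i))

/-- For a weight `W : Jᵒᵖ ⥤ C` and a diagram `G : J ⥤ D`, a `C`-natural family
`W j ⟶ D(G j, L)`, that is, a weighted cocone with vertex `L`. -/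
structure WeightedCocone (W : EnrichedFunctor C Jᵒᵖ C) (G : EnrichedFunctor C J D) where
  /-- The vertex. -/
  pt : D
  /-- The components. -/
  leg : ∀ j : J, W.obj (Opposite.op j) ⟶ (G.obj j ⟶[C] pt)
  naturality : ∀ i j : J,
    (G.map i j ⊗ₘ leg j) ≫ eComp C (G.obj i) (G.obj j) pt = weightAct W i j ≫ leg i

/-- A family `W j ⊗ A ⟶ D(G j, Y)` is `C`-natural in `j`. Such families are the generalized
elements, with domain `A`, of the object of `C`-natural families `W j ⟶ D(G j, Y)`. -/
def IsNaturalFamily (W : EnrichedFunctor C Jᵒᵖ C) (G : EnrichedFunctor C J D) (A : C) (Y : D)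
    (φ : ∀ j : J, W.obj (Opposite.op j) ⊗ A ⟶ (G.obj j ⟶[C] Y)) : Prop :=
  ∀ i j : J, (G.map i j ⊗ₘ φ j) ≫ eComp C (G.obj i) (G.obj j) Y =
    (α_ _ _ _).inv ≫ weightAct W i j ▷ A ≫ φ i

/-- A weighted cocone with vertex `L` exhibits `L` as the weighted colimit of `G` by `W`: for each
`Y` the hom-object `D(L, Y)` represents, by composition with the cocone, the `C`-natural families
`W j ⟶ D(G j, Y)`. In other words `D(L, Y)` is the end of `[W j, D(G j, Y)]` over `j`. -/
def WeightedCocone.IsColimit {W : EnrichedFunctor C Jᵒᵖ C} {G : EnrichedFunctor C J D}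
    (c : WeightedCocone W G) : Prop :=
  ∀ (A : C) (Y : D) (φ : ∀ j : J, W.obj (Opposite.op j) ⊗ A ⟶ (G.obj j ⟶[C] Y)),
    IsNaturalFamily W G A Y φ →
      ∃! h : A ⟶ (c.pt ⟶[C] Y), ∀ j, (c.leg j ⊗ₘ h) ≫ eComp C (G.obj j) c.pt Y = φ j

/-- The image of a weighted cocone under an enriched functor. -/
def WeightedCocone.map {W : EnrichedFunctor C Jᵒᵖ C} {G : EnrichedFunctor C J D}
    (c : WeightedCocone W G) (F : EnrichedFunctor C D E) : WeightedCocone W (G.comp C F) where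
  pt := F.obj c.pt
  leg j := c.leg j ≫ F.map (G.obj j) c.pt
  naturality i j := by
    have h := c.naturality i j
    change star (G.map i j) (c.leg j) = _ at h
    change star (G.map i j ≫ F.map _ _) (c.leg j ≫ F.map _ _) = _
    rw [← star_map, h, Category.assoc]
    rfl

/-- A `C`-enriched functor is cocontinuous if it preserves all weighted colimits, indexed by
`C`-categories `J` with objects in `Type w`, which exist in its source. The universe `w` is a
parameter which fixes the size of the indexing `C`-categories. -/
def IsCocontinuous (F : EnrichedFunctor C D E) : Prop :=
  ∀ (J : Type w) [EnrichedCategory C J] (W : EnrichedFunctor C Jᵒᵖ C)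
    (G : EnrichedFunctor C J D) (c : WeightedCocone W G), c.IsColimit → (c.map F).IsColimit

end Cocontinuity

section Modules

open MonoidalClosed MonObj

variable {C : Type u} [Category.{v} C] [MonoidalCategory C] [SymmetricCategory C]

/-- A right module over the monoid `b`. -/
structure RightModule (b : Mon C) where
  /-- The underlying object. -/
  X : C
  /-- The right action. -/
  act : X ⊗ b.X ⟶ X
  act_one : X ◁ η[b.X] ≫ act = (ρ_ X).hom
  act_assoc : X ◁ μ[b.X] ≫ act = (α_ X b.X b.X).inv ≫ act ▷ b.X ≫ act

namespace RightModule

variable {b : Mon C}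

variable (b) in
/-- The monoid `b` as a right module over itself. -/
abbrev regular : RightModule b where
  X := b.X
  act := μ[b.X]
  act_one := MonObj.mul_one b.X
  act_assoc := by
    rw [MonObj.mul_assoc, Iso.inv_hom_id_assoc]

/-- A morphism `m ⊗ a ⟶ n`, regarded as a family of morphisms `m ⟶ n` indexed by `a`, consists of
morphisms of right modules. -/
def IsLinear {M N : RightModule b} {A : C} (f : M.X ⊗ A ⟶ N.X) : Prop :=
  M.act ▷ A ≫ f = swap M.X b.X A ≫ f ▷ b.X ≫ N.act

theorem isLinear_unit (M : RightModule b) : IsLinear (M := M) (N := M) (ρ_ M.X).hom := by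
  rw [IsLinear, rightUnitor_naturality, ← swap_unit, Category.assoc]

theorem isLinear_comp {M N P : RightModule b} {A B : C} {f : M.X ⊗ A ⟶ N.X} {g : N.X ⊗ B ⟶ P.X}
    (hf : IsLinear f) (hg : IsLinear g) :
    IsLinear (M := M) (N := P) ((α_ M.X A B).inv ≫ f ▷ B ≫ g) := by
  rw [IsLinear] at *
  rw [associator_inv_naturality_left_assoc, ← comp_whiskerRight_assoc, hf]
  simp only [comp_whiskerRight, Category.assoc]
  rw [hg, ← Category.assoc (f ▷ b.X ▷ B), swap_nat_left]
  have := swap_tensor_right M.X b.X A B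
  rw [← reassoc_of% this]
  simp only [Category.assoc]

variable [MonoidalClosed C]

/-- The morphism `[m, n] ⟶ [m ⊗ b, n]` given by restriction along the action of `m`. -/
def actPre (M N : RightModule b) : (ihom M.X).obj N.X ⟶ (ihom (M.X ⊗ b.X)).obj N.X :=
  (pre M.act).app N.X

/-- The morphism `[m, n] ⟶ [m ⊗ b, n ⊗ b] ⟶ [m ⊗ b, n]` given by tensoring with `b` and by the
action of `n`. -/
def actPost (M N : RightModule b) : (ihom M.X).obj N.X ⟶ (ihom (M.X ⊗ b.X)).obj N.X :=
  curry (swap M.X b.X ((ihom M.X).obj N.X) ≫ (ihom.ev M.X).app N.X ▷ b.X ≫ N.act)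

theorem comp_actPre_eq_iff {M N : RightModule b} {A : C} (f : M.X ⊗ A ⟶ N.X) :
    curry f ≫ actPre M N = curry f ≫ actPost M N ↔ IsLinear f := by
  have h₁ : curry f ≫ actPre M N = curry (M.act ▷ A ≫ f) := by
    rw [actPre, curry_pre_app]
  have h₂ : curry f ≫ actPost M N = curry (swap M.X b.X A ≫ f ▷ b.X ≫ N.act) := by
    rw [actPost, ← curry_natural_left, ← Category.assoc, swap_nat_right, Category.assoc,
      ← comp_whiskerRight_assoc, whiskerLeft_curry_ihom_ev_app]
  rw [h₁, h₂]
  exact curry_injective.eq_iff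

variable [HasEqualizers C]

/-- The hom-object of right modules: the equalizer of `[m, n] ⇉ [m ⊗ b, n]`. -/
noncomputable def homObj (M N : RightModule b) : C :=
  equalizer (actPre M N) (actPost M N)

/-- The inclusion of the hom-object of right modules into the internal hom of `C`. -/
noncomputable def homι (M N : RightModule b) : homObj M N ⟶ (ihom M.X).obj N.X :=
  equalizer.ι (actPre M N) (actPost M N)

theorem homι_condition (M N : RightModule b) :
    homι M N ≫ actPre M N = homι M N ≫ actPost M N :=
  equalizer.condition (actPre M N) (actPost M N)

theorem homι_ext {M N : RightModule b} {A : C} {g h : A ⟶ homObj M N}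
    (w : g ≫ homι M N = h ≫ homι M N) : g = h :=
  equalizer.hom_ext w

/-- The evaluation of the hom-object. -/
noncomputable def homEv (M N : RightModule b) : M.X ⊗ homObj M N ⟶ N.X :=
  uncurry (homι M N)

theorem homEv_eq {M N : RightModule b} {A : C} (g : A ⟶ homObj M N) :
    M.X ◁ g ≫ homEv M N = uncurry (g ≫ homι M N) := by
  rw [homEv, uncurry_natural_left]

theorem isLinear_homEv {M N : RightModule b} {A : C} (g : A ⟶ homObj M N) :
    IsLinear (M.X ◁ g ≫ homEv M N) := by
  rw [← comp_actPre_eq_iff, homEv_eq, curry_uncurry, Category.assoc, Category.assoc,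
    homι_condition]

theorem homObj_ext {M N : RightModule b} {A : C} {g h : A ⟶ homObj M N}
    (w : M.X ◁ g ≫ homEv M N = M.X ◁ h ≫ homEv M N) : g = h := by
  rw [homEv_eq, homEv_eq] at w
  exact homι_ext (uncurry_injective w)

/-- The morphism into the hom-object classifying a family of module morphisms. -/
noncomputable def homLift {M N : RightModule b} {A : C} (f : M.X ⊗ A ⟶ N.X) (hf : IsLinear f) :
    A ⟶ homObj M N :=
  equalizer.lift (curry f) ((comp_actPre_eq_iff f).2 hf)

theorem homLift_ι {M N : RightModule b} {A : C} (f : M.X ⊗ A ⟶ N.X) (hf : IsLinear f) :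
    homLift f hf ≫ homι M N = curry f :=
  equalizer.lift_ι _ _

theorem homLift_ev {M N : RightModule b} {A : C} (f : M.X ⊗ A ⟶ N.X) (hf : IsLinear f) :
    M.X ◁ homLift f hf ≫ homEv M N = f := by
  rw [homEv_eq, homLift_ι, uncurry_curry]

theorem isLinear_homEv' (M N : RightModule b) : IsLinear (homEv M N) := by
  simpa using isLinear_homEv (𝟙 (homObj M N))

/-- The composition of the hom-objects of right modules. -/
noncomputable def homComp (M N P : RightModule b) : homObj M N ⊗ homObj N P ⟶ homObj M P :=
  homLift _ (isLinear_comp (isLinear_homEv' M N) (isLinear_homEv' N P))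

theorem homComp_ev (M N P : RightModule b) : M.X ◁ homComp M N P ≫ homEv M P =
    (α_ _ _ _).inv ≫ homEv M N ▷ homObj N P ≫ homEv N P :=
  homLift_ev _ _

theorem homComp_ev' {M N P : RightModule b} {A B : C} (f : A ⟶ homObj M N) (g : B ⟶ homObj N P) :
    M.X ◁ ((f ⊗ₘ g) ≫ homComp M N P) ≫ homEv M P =
      (α_ _ _ _).inv ≫ (M.X ◁ f ≫ homEv M N) ▷ B ≫ N.X ◁ g ≫ homEv N P := by
  rw [MonoidalCategory.whiskerLeft_comp, Category.assoc, homComp_ev,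
    MonoidalCategory.tensorHom_def, MonoidalCategory.whiskerLeft_comp, Category.assoc,
    associator_inv_naturality_right_assoc, whisker_exchange_assoc,
    associator_inv_naturality_middle_assoc, comp_whiskerRight, Category.assoc]

/-- The identities in the hom-objects of right modules. -/
noncomputable def homId (M : RightModule b) : 𝟙_ C ⟶ homObj M M :=
  homLift _ (isLinear_unit M)

theorem homId_ev (M : RightModule b) : M.X ◁ homId M ≫ homEv M M = (ρ_ M.X).hom :=
  homLift_ev _ _

/-- The `C`-enriched category of right modules over `b`. -/
noncomputable instance enrichedCategory : EnrichedCategory C (RightModule b) where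
  Hom := homObj
  id := homId
  comp := homComp
  id_comp M N := by
    apply homObj_ext
    simp only [MonoidalCategory.whiskerLeft_comp, Category.assoc]
    rw [homComp_ev, associator_inv_naturality_middle_assoc, ← comp_whiskerRight_assoc, homId_ev]
    simp
  comp_id M N := by
    apply homObj_ext
    simp only [MonoidalCategory.whiskerLeft_comp, Category.assoc]
    rw [homComp_ev, associator_inv_naturality_right_assoc, whisker_exchange_assoc, homId_ev]
    simp
  assoc M N P Q := by
    apply homObj_ext
    simp only [MonoidalCategory.whiskerLeft_comp, Category.assoc]
    rw [homComp_ev, associator_inv_naturality_middle_assoc, ← comp_whiskerRight_assoc, homComp_ev,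
      homComp_ev, associator_inv_naturality_right_assoc, whisker_exchange_assoc, homComp_ev]
    simp

end RightModule

end Modules

section Tensor

open MonoidalClosed MonObj RightModule

variable {C : Type u} [Category.{v} C] [MonoidalCategory C] [HasCoequalizers C]
  {b b' : Mon C}

/-- The tensor product `z ⊗_b x` of a right module and a bimodule: the coequalizer of the two
morphisms `z ⊗ b ⊗ x ⇉ z ⊗ x` given by the actions of `b` on `z` and on `x`. -/
noncomputable def tensorObj (z : RightModule b) (x : Bimod b b') : C :=
  coequalizer (z.act ▷ x.X) ((α_ z.X b.X x.X).hom ≫ z.X ◁ x.actLeft)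

/-- The projection `z ⊗ x ⟶ z ⊗_b x`. -/
noncomputable def tensorπ (z : RightModule b) (x : Bimod b b') : z.X ⊗ x.X ⟶ tensorObj z x :=
  coequalizer.π (z.act ▷ x.X) ((α_ z.X b.X x.X).hom ≫ z.X ◁ x.actLeft)

theorem tensorπ_condition (z : RightModule b) (x : Bimod b b') :
    z.act ▷ x.X ≫ tensorπ z x = ((α_ z.X b.X x.X).hom ≫ z.X ◁ x.actLeft) ≫ tensorπ z x :=
  coequalizer.condition _ _

/-- A morphism `(z ⊗ x) ⊗ a ⟶ w` coequalizes the two actions of `b`. -/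
def IsBalanced {z : RightModule b} {x : Bimod b b'} {A W : C} (f : (z.X ⊗ x.X) ⊗ A ⟶ W) : Prop :=
  z.act ▷ x.X ▷ A ≫ f = ((α_ z.X b.X x.X).hom ≫ z.X ◁ x.actLeft) ▷ A ≫ f

theorem isBalanced_act (z : RightModule b) (x : Bimod b b') :
    IsBalanced (z := z) (x := x)
      ((α_ z.X x.X b'.X).hom ≫ z.X ◁ x.actRight ≫ tensorπ z x) := by
  rw [IsBalanced, associator_naturality_left_assoc, ← whisker_exchange_assoc, tensorπ_condition]
  simp only [comp_whiskerRight, Category.assoc]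
  rw [associator_naturality_middle_assoc, ← MonoidalCategory.whiskerLeft_comp_assoc,
    x.middle_assoc]
  simp

variable [SymmetricCategory C] [MonoidalClosed C]

/-- The functor `- ⊗ a` preserves the coequalizer which defines `z ⊗_b x`. -/
noncomputable def tensorIsColimit (z : RightModule b) (x : Bimod b b') (A : C) :
    IsColimit (Cofork.ofπ (f := z.act ▷ x.X ▷ A)
      (g := ((α_ z.X b.X x.X).hom ≫ z.X ◁ x.actLeft) ▷ A) (tensorπ z x ▷ A)
      (by rw [← comp_whiskerRight, tensorπ_condition, comp_whiskerRight])) :=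
  isColimitCoforkMapOfIsColimit (tensorRight A) (tensorπ_condition z x)
    (coequalizerIsCoequalizer _ _)

/-- The morphism out of `(z ⊗_b x) ⊗ a` induced by a balanced morphism. -/
noncomputable def tensorDesc {z : RightModule b} {x : Bimod b b'} {A W : C}
    (f : (z.X ⊗ x.X) ⊗ A ⟶ W) (hf : IsBalanced f) : tensorObj z x ⊗ A ⟶ W :=
  (tensorIsColimit z x A).desc (Cofork.ofπ f hf)

theorem tensorπ_desc {z : RightModule b} {x : Bimod b b'} {A W : C}
    (f : (z.X ⊗ x.X) ⊗ A ⟶ W) (hf : IsBalanced f) : tensorπ z x ▷ A ≫ tensorDesc f hf = f :=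
  Cofork.IsColimit.π_desc' (tensorIsColimit z x A) _ _

theorem tensorObj_ext {z : RightModule b} {x : Bimod b b'} {A W : C}
    {f g : tensorObj z x ⊗ A ⟶ W} (h : tensorπ z x ▷ A ≫ f = tensorπ z x ▷ A ≫ g) : f = g :=
  Cofork.IsColimit.hom_ext (tensorIsColimit z x A) h

theorem tensorObj_ext₂ {z : RightModule b} {x : Bimod b b'} {A B W : C}
    {f g : (tensorObj z x ⊗ A) ⊗ B ⟶ W}
    (h : tensorπ z x ▷ A ▷ B ≫ f = tensorπ z x ▷ A ▷ B ≫ g) : f = g := by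
  rw [← cancel_epi (α_ _ _ _).inv]
  apply tensorObj_ext
  rw [associator_inv_naturality_left_assoc, associator_inv_naturality_left_assoc, h]

/-- The right module `z ⊗_b x` over `b'`. -/
noncomputable def tensorModule (z : RightModule b) (x : Bimod b b') : RightModule b' where
  X := tensorObj z x
  act := tensorDesc _ (isBalanced_act z x)
  act_one := by
    apply tensorObj_ext
    rw [← whisker_exchange_assoc, tensorπ_desc, associator_naturality_right_assoc,
      ← MonoidalCategory.whiskerLeft_comp_assoc, x.actRight_one]
    simp
  act_assoc := by
    apply tensorObj_ext
    rw [← whisker_exchange_assoc, tensorπ_desc, associator_naturality_right_assoc,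
      ← MonoidalCategory.whiskerLeft_comp_assoc, x.right_assoc,
      associator_inv_naturality_left_assoc, ← comp_whiskerRight_assoc, tensorπ_desc]
    simp only [comp_whiskerRight, Category.assoc]
    rw [tensorπ_desc, associator_naturality_middle_assoc]
    simp

/-- The projection `z ⊗ x ⟶ z ⊗_b x`, with the module `z ⊗_b x` as its target. -/
noncomputable def tensorPr (z : RightModule b) (x : Bimod b b') :
    z.X ⊗ x.X ⟶ (tensorModule z x).X :=
  tensorπ z x

theorem tensorPr_act (z : RightModule b) (x : Bimod b b') :
    tensorPr z x ▷ b'.X ≫ (tensorModule z x).act =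
      (α_ z.X x.X b'.X).hom ≫ z.X ◁ x.actRight ≫ tensorPr z x :=
  tensorπ_desc _ (isBalanced_act z x)

theorem tensorPr_condition (z : RightModule b) (x : Bimod b b') :
    z.act ▷ x.X ≫ tensorPr z x = (α_ z.X b.X x.X).hom ≫ z.X ◁ x.actLeft ≫ tensorPr z x :=
  (tensorπ_condition z x).trans (Category.assoc _ _ _)

theorem tensorModule_ext {z : RightModule b} {x : Bimod b b'} {A W : C}
    {f g : (tensorModule z x).X ⊗ A ⟶ W} (h : tensorPr z x ▷ A ≫ f = tensorPr z x ▷ A ≫ g) :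
    f = g :=
  tensorObj_ext h

theorem tensorModule_ext₂ {z : RightModule b} {x : Bimod b b'} {A B W : C}
    {f g : ((tensorModule z x).X ⊗ A) ⊗ B ⟶ W}
    (h : tensorPr z x ▷ A ▷ B ≫ f = tensorPr z x ▷ A ▷ B ≫ g) : f = g :=
  tensorObj_ext₂ h

/-- The morphism out of `(z ⊗_b x) ⊗ a` induced by a balanced morphism. -/
noncomputable def tensorLift {z : RightModule b} {x : Bimod b b'} {A W : C}
    (f : (z.X ⊗ x.X) ⊗ A ⟶ W) (hf : IsBalanced f) : (tensorModule z x).X ⊗ A ⟶ W :=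
  tensorDesc f hf

theorem tensorPr_lift {z : RightModule b} {x : Bimod b b'} {A W : C}
    (f : (z.X ⊗ x.X) ⊗ A ⟶ W) (hf : IsBalanced f) : tensorPr z x ▷ A ≫ tensorLift f hf = f :=
  tensorπ_desc f hf

theorem isBalanced_map {z z' : RightModule b} (x : Bimod b b') {A : C} {f : z.X ⊗ A ⟶ z'.X}
    (hf : IsLinear f) :
    IsBalanced (z := z) (x := x) (swap z.X x.X A ≫ f ▷ x.X ≫ tensorPr z' x) := by
  have key := swap_tensor_mid z.X b.X x.X A
  rw [IsLinear] at hf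
  rw [IsBalanced, ← Category.assoc, swap_nat_left, Category.assoc, ← comp_whiskerRight_assoc, hf]
  simp only [comp_whiskerRight, Category.assoc]
  rw [tensorPr_condition, ← Category.assoc ((z.X ◁ x.actLeft) ▷ A), swap_nat_mid, Category.assoc,
    whisker_exchange_assoc, ← reassoc_of% key]
  simp

theorem isLinear_map {z z' : RightModule b} (x : Bimod b b') {A : C}
    (f : z.X ⊗ A ⟶ z'.X) (hf : IsLinear f) :
    IsLinear (M := tensorModule z x) (N := tensorModule z' x)
      (tensorLift _ (isBalanced_map x hf)) := by
  have key := swap_tensor_mid z.X x.X b'.X A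
  apply tensorModule_ext₂
  rw [← comp_whiskerRight_assoc, tensorPr_act, ← Category.assoc (tensorPr z x ▷ b'.X ▷ A),
    swap_nat_left, Category.assoc, ← comp_whiskerRight_assoc (tensorPr z x ▷ A), tensorPr_lift]
  simp only [comp_whiskerRight, Category.assoc]
  rw [tensorPr_lift, tensorPr_act, ← Category.assoc ((z.X ◁ x.actRight) ▷ A), swap_nat_mid,
    Category.assoc, whisker_exchange_assoc, ← reassoc_of% key]
  simp

variable [HasEqualizers C]

/-- The action of the functor `- ⊗_b x` on hom-objects: it is determined by the commutativity of
the square formed by the evaluations and the projections `z ⊗ x ⟶ z ⊗_b x`. -/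
noncomputable def tensorMap (z z' : RightModule b) (x : Bimod b b') :
    homObj z z' ⟶ homObj (tensorModule z x) (tensorModule z' x) :=
  homLift _ (isLinear_map x (homEv z z') (isLinear_homEv' z z'))

theorem tensorPr_map (z z' : RightModule b) (x : Bimod b b') :
    tensorPr z x ▷ homObj z z' ≫ (tensorModule z x).X ◁ tensorMap z z' x ≫ homEv _ _ =
      swap z.X x.X (homObj z z') ≫ homEv z z' ▷ x.X ≫ tensorPr z' x := by
  rw [tensorMap, homLift_ev, tensorPr_lift]

/-- The `C`-enriched functor `- ⊗_b x` from right modules over `b` to right modules over `b'`. -/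
noncomputable def tensorEnrichedFunctor (x : Bimod b b') :
    EnrichedFunctor C (RightModule b) (RightModule b') where
  obj z := tensorModule z x
  map z z' := tensorMap z z' x
  map_id z := by
    apply homObj_ext
    apply tensorModule_ext
    change _ ≫ _ ◁ (homId z ≫ _) ≫ _ = _ ≫ _ ◁ homId (tensorModule z x) ≫ _
    rw [homId_ev, MonoidalCategory.whiskerLeft_comp, Category.assoc, ← whisker_exchange_assoc,
      tensorPr_map, rightUnitor_naturality, ← Category.assoc (_ ◁ homId z), swap_nat_right,
      Category.assoc, ← comp_whiskerRight_assoc, homId_ev, ← Category.assoc, swap_unit]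
  map_comp z z' z'' := by
    apply homObj_ext
    apply tensorModule_ext
    change _ ≫ _ ◁ (homComp z z' z'' ≫ tensorMap z z'' x) ≫ _ =
      _ ≫ _ ◁ ((tensorMap z z' x ⊗ₘ tensorMap z' z'' x) ≫
        homComp (tensorModule z x) (tensorModule z' x) (tensorModule z'' x)) ≫ _
    have key := swap_tensor_right z.X x.X (homObj z z') (homObj z' z'')
    have hL : tensorPr z x ▷ _ ≫ (tensorModule z x).X ◁ (homComp z z' z'' ≫ tensorMap z z'' x) ≫
        homEv _ _ = swap z.X x.X _ ≫ ((α_ _ _ _).inv ≫ homEv z z' ▷ homObj z' z'' ≫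
          homEv z' z'') ▷ x.X ≫ tensorPr z'' x := by
      rw [MonoidalCategory.whiskerLeft_comp, Category.assoc, ← whisker_exchange_assoc,
        tensorPr_map, ← Category.assoc (_ ◁ homComp z z' z''), swap_nat_right,
        Category.assoc, ← comp_whiskerRight_assoc, homComp_ev]
    have hR : tensorPr z x ▷ _ ≫ (tensorModule z x).X ◁
        ((tensorMap z z' x ⊗ₘ tensorMap z' z'' x) ≫
          homComp (tensorModule z x) (tensorModule z' x) (tensorModule z'' x)) ≫ homEv _ _ =
        (α_ _ _ _).inv ≫ (swap z.X x.X (homObj z z') ≫ homEv z z' ▷ x.X) ▷ homObj z' z'' ≫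
          swap z'.X x.X (homObj z' z'') ≫ homEv z' z'' ▷ x.X ≫ tensorPr z'' x := by
      rw [homComp_ev', associator_inv_naturality_left_assoc, ← comp_whiskerRight_assoc,
        tensorPr_map, ← Category.assoc (swap z.X x.X _), comp_whiskerRight, Category.assoc,
        tensorPr_map]
    refine hL.trans (Eq.trans ?_ hR.symm)
    simp only [comp_whiskerRight, Category.assoc]
    rw [← Category.assoc (homEv z z' ▷ x.X ▷ _), swap_nat_left, Category.assoc,
      reassoc_of% key]

end Tensor

section TensorFunctor

open MonoidalClosed MonObj RightModule

variable {C : Type u} [Category.{v} C] [MonoidalCategory C] [SymmetricCategory C]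
  [MonoidalClosed C] [HasCoequalizers C] {b b' : Mon C}

theorem isBalanced_transApp (z : RightModule b) {x x' : Bimod b b'} (g : x ⟶ x') :
    IsBalanced (z := z) (x := x) ((ρ_ (z.X ⊗ x.X)).hom ≫ z.X ◁ g.hom ≫ tensorPr z x') := by
  rw [IsBalanced, rightUnitor_naturality_assoc, rightUnitor_naturality_assoc,
    ← whisker_exchange_assoc, tensorPr_condition, Category.assoc,
    ← MonoidalCategory.whiskerLeft_comp_assoc z.X x.actLeft, g.left_act_hom]
  simp

theorem isLinear_transApp (z : RightModule b) {x x' : Bimod b b'} (g : x ⟶ x') :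
    IsLinear (M := tensorModule z x) (N := tensorModule z x')
      (tensorLift _ (isBalanced_transApp z g)) := by
  apply tensorModule_ext₂
  rw [← comp_whiskerRight_assoc, tensorPr_act, ← Category.assoc (tensorPr z x ▷ b'.X ▷ _),
    swap_nat_left, Category.assoc, ← comp_whiskerRight_assoc (tensorPr z x ▷ _), tensorPr_lift]
  have h := swap_unit (z.X ⊗ x.X) b'.X
  simp only [comp_whiskerRight, Category.assoc]
  rw [tensorPr_lift, tensorPr_act, reassoc_of% h, rightUnitor_naturality_assoc,
    ← MonoidalCategory.whiskerLeft_comp_assoc z.X x.actRight, g.right_act_hom,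
    rightUnitor_naturality_assoc]
  simp

variable [HasEqualizers C]

/-- The components `z ⊗_b x ⟶ z ⊗_b x'` of the transformation induced by a morphism of
bimodules. -/
noncomputable def tensorTransApp (z : RightModule b) {x x' : Bimod b b'} (g : x ⟶ x') :
    𝟙_ C ⟶ homObj (tensorModule z x) (tensorModule z x') :=
  homLift _ (isLinear_transApp z g)

theorem tensorPr_transApp (z : RightModule b) {x x' : Bimod b b'} (g : x ⟶ x') :
    tensorPr z x ▷ 𝟙_ C ≫ (tensorModule z x).X ◁ tensorTransApp z g ≫ homEv _ _ =
      (ρ_ (z.X ⊗ x.X)).hom ≫ z.X ◁ g.hom ≫ tensorPr z x' := by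
  rw [tensorTransApp, homLift_ev, tensorPr_lift]

/-- The `C`-enriched natural transformation `- ⊗_b x ⟶ - ⊗_b x'` induced by a morphism of
bimodules. -/
noncomputable def tensorTrans {x x' : Bimod b b'} (g : x ⟶ x') :
    EnrichedTrans (tensorEnrichedFunctor x) (tensorEnrichedFunctor x') where
  app z := tensorTransApp z g
  naturality z z' := by
    apply homObj_ext
    apply tensorModule_ext
    have hL : tensorPr z x ▷ homObj z z' ≫ (tensorModule z x).X ◁ ((λ_ (homObj z z')).inv ≫
        (tensorTransApp z g ⊗ₘ tensorMap z z' x') ≫ homComp _ _ _) ≫ homEv _ _ =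
        (z.X ◁ g.hom) ▷ homObj z z' ≫ swap z.X x'.X (homObj z z') ≫ homEv z z' ▷ x'.X ≫
          tensorPr z' x' := by
      rw [MonoidalCategory.whiskerLeft_comp, Category.assoc, homComp_ev', ← whisker_exchange_assoc,
        associator_inv_naturality_left_assoc, ← comp_whiskerRight_assoc, tensorPr_transApp,
        comp_whiskerRight, comp_whiskerRight, Category.assoc, Category.assoc, tensorPr_map]
      simp
    have hR : tensorPr z x ▷ homObj z z' ≫ (tensorModule z x).X ◁ ((ρ_ (homObj z z')).inv ≫
        (tensorMap z z' x ⊗ₘ tensorTransApp z' g) ≫ homComp _ _ _) ≫ homEv _ _ =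
        swap z.X x.X (homObj z z') ≫ homEv z z' ▷ x.X ≫ z'.X ◁ g.hom ≫ tensorPr z' x' := by
      rw [MonoidalCategory.whiskerLeft_comp, Category.assoc, homComp_ev', ← whisker_exchange_assoc,
        associator_inv_naturality_left_assoc, ← comp_whiskerRight_assoc, tensorPr_map,
        ← Category.assoc (swap z.X x.X _), comp_whiskerRight, Category.assoc, tensorPr_transApp,
        rightUnitor_naturality_assoc]
      simp
    refine hL.trans (Eq.trans ?_ hR.symm)
    rw [← Category.assoc, swap_nat_mid, Category.assoc, whisker_exchange_assoc]

/-- The functor `x ↦ - ⊗_b x` from bimodules to `C`-enriched functors. -/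
noncomputable def tensorFunctor (b b' : Mon C) :
    Bimod b b' ⥤ EnrichedFunct C (RightModule b) (RightModule b') where
  obj x := ⟨tensorEnrichedFunctor x⟩
  map g := tensorTrans g
  map_id x := by
    refine EnrichedTrans.ext (funext fun z => ?_)
    apply homObj_ext
    apply tensorModule_ext
    refine (tensorPr_transApp z (𝟙 x)).trans (Eq.trans ?_ (congrArg _ (homId_ev _)).symm)
    change _ = tensorPr z x ▷ 𝟙_ C ≫ (ρ_ (tensorModule z x).X).hom
    rw [rightUnitor_naturality]
    simp
  map_comp {x x' x''} g h := by
    refine EnrichedTrans.ext (funext fun z => ?_)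
    apply homObj_ext
    apply tensorModule_ext
    refine (tensorPr_transApp z (g ≫ h)).trans ?_
    change _ = _ ≫ _ ◁ ((λ_ (𝟙_ C)).inv ≫ (tensorTransApp z g ⊗ₘ tensorTransApp z h) ≫
      homComp _ _ _) ≫ homEv _ _
    rw [MonoidalCategory.whiskerLeft_comp, Category.assoc, homComp_ev', ← whisker_exchange_assoc,
        associator_inv_naturality_left_assoc, ← comp_whiskerRight_assoc, tensorPr_transApp,
        comp_whiskerRight, comp_whiskerRight, Category.assoc, Category.assoc, tensorPr_transApp,
        rightUnitor_naturality_assoc]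
    have e : (z.X ⊗ x.X) ◁ (λ_ (𝟙_ C)).inv ≫ (α_ _ _ _).inv ≫ (ρ_ (z.X ⊗ x.X)).hom ▷ 𝟙_ C =
        𝟙 _ := by
      monoidal
    rw [reassoc_of% e]
    simp

end TensorFunctor

section Evaluation

open MonoidalClosed MonObj RightModule

variable {C : Type u} [Category.{v} C] [MonoidalCategory C] [SymmetricCategory C]
  {b b' : Mon C}

theorem isLinear_leftMul (b : Mon C) :
    IsLinear (M := regular b) (N := regular b) ((β_ b.X b.X).hom ≫ μ[b.X]) := by
  change μ[b.X] ▷ b.X ≫ (β_ b.X b.X).hom ≫ μ[b.X] =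
    swap b.X b.X b.X ≫ ((β_ b.X b.X).hom ≫ μ[b.X]) ▷ b.X ≫ μ[b.X]
  rw [BraidedCategory.braiding_naturality_left_assoc, comp_whiskerRight, Category.assoc,
    MonObj.mul_assoc, BraidedCategory.braiding_tensor_left_hom]
  simp [swap]

variable [MonoidalClosed C] [HasEqualizers C]

/-- The morphism `b ⟶ Mod_b(b_b, b_b)` which corresponds to the multiplication, regarded as the
action `b ⊗ b_b ⟶ b_b` by left multiplication. -/
noncomputable def leftMul (b : Mon C) : b.X ⟶ homObj (regular b) (regular b) :=
  homLift _ (isLinear_leftMul b)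

theorem leftMul_ev (b : Mon C) :
    b.X ◁ leftMul b ≫ homEv (regular b) (regular b) = (β_ b.X b.X).hom ≫ μ[b.X] :=
  homLift_ev _ (isLinear_leftMul b)

theorem one_leftMul (b : Mon C) : η[b.X] ≫ leftMul b = homId (regular b) := by
  apply homObj_ext
  rw [homId_ev, MonoidalCategory.whiskerLeft_comp, Category.assoc]
  change b.X ◁ η[b.X] ≫ b.X ◁ leftMul b ≫ _ = (ρ_ b.X).hom
  rw [leftMul_ev, BraidedCategory.braiding_naturality_right_assoc, MonObj.one_mul]
  simp

theorem mul_leftMul (b : Mon C) : μ[b.X] ≫ leftMul b =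
    (β_ b.X b.X).hom ≫ (leftMul b ⊗ₘ leftMul b) ≫ homComp _ _ _ := by
  apply homObj_ext
  rw [MonoidalCategory.whiskerLeft_comp, Category.assoc, MonoidalCategory.whiskerLeft_comp,
    Category.assoc, homComp_ev']
  change b.X ◁ μ[b.X] ≫ b.X ◁ leftMul b ≫ _ =
    b.X ◁ (β_ b.X b.X).hom ≫ (α_ b.X _ _).inv ≫ (b.X ◁ leftMul b ≫ _) ▷ _ ≫ b.X ◁ leftMul b ≫ _
  have h := braiding_three' b.X b.X b.X
  rw [leftMul_ev, BraidedCategory.braiding_naturality_right_assoc, comp_whiskerRight,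
    Category.assoc, BraidedCategory.braiding_naturality_left_assoc, MonObj.mul_assoc,
    ← reassoc_of% h]

/-- The morphism `b ⟶ Mod_b'(F(b_b), F(b_b))` induced by left multiplication. -/
noncomputable def evalAdjunct (F : EnrichedFunctor C (RightModule b) (RightModule b')) :
    b.X ⟶ homObj (F.obj (regular b)) (F.obj (regular b)) :=
  leftMul b ≫ F.map (regular b) (regular b)

/-- The left action `b ⊗ F(b_b) ⟶ F(b_b)` corresponding to the composite
`b ⟶ Mod_b(b_b, b_b) ⟶ Mod_b'(F(b_b), F(b_b))`. Equivalently it is the tensorial strength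
`b ⊗ F(b_b) ⟶ F(b ⊗ b_b)` of `F` followed by the image under `F` of the multiplication
`b ⊗ b_b ⟶ b_b`. -/
noncomputable def evalAct (F : EnrichedFunctor C (RightModule b) (RightModule b')) :
    b.X ⊗ (F.obj (regular b)).X ⟶ (F.obj (regular b)).X :=
  (β_ _ _).hom ≫ (F.obj (regular b)).X ◁ evalAdjunct F ≫ homEv _ _

theorem one_evalAdjunct (F : EnrichedFunctor C (RightModule b) (RightModule b')) :
    η[b.X] ≫ evalAdjunct F = homId (F.obj (regular b)) := by
  rw [evalAdjunct, ← Category.assoc, one_leftMul]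
  exact F.map_id (regular b)

theorem mul_evalAdjunct (F : EnrichedFunctor C (RightModule b) (RightModule b')) :
    μ[b.X] ≫ evalAdjunct F =
      (β_ b.X b.X).hom ≫ (evalAdjunct F ⊗ₘ evalAdjunct F) ≫ homComp _ _ _ := by
  rw [evalAdjunct, ← Category.assoc, mul_leftMul, Category.assoc, Category.assoc]
  have h := star_map F (leftMul b) (leftMul b)
  simp only [star, Category.assoc] at h
  exact congrArg _ h

/-- The `(b, b')`-bimodule `F(b_b)`. -/
noncomputable def evalBimod (F : EnrichedFunctor C (RightModule b) (RightModule b')) :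
    Bimod b b' where
  X := (F.obj (regular b)).X
  actLeft := evalAct F
  actRight := (F.obj (regular b)).act
  one_actLeft := by
    rw [evalAct, BraidedCategory.braiding_naturality_left_assoc,
      ← MonoidalCategory.whiskerLeft_comp_assoc, one_evalAdjunct, homId_ev]
    simp
  left_assoc := by
    rw [evalAct, BraidedCategory.braiding_naturality_left_assoc,
      ← MonoidalCategory.whiskerLeft_comp_assoc, mul_evalAdjunct,
      MonoidalCategory.whiskerLeft_comp, Category.assoc, homComp_ev']
    have h := braiding_three (F.obj (regular b)).X b.X b.X
    rw [reassoc_of% h, MonoidalCategory.whiskerLeft_comp, Category.assoc,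
      BraidedCategory.braiding_naturality_right_assoc b.X
        ((F.obj (regular b)).X ◁ evalAdjunct F ≫ homEv _ _)]
  actRight_one := (F.obj (regular b)).act_one
  right_assoc := (F.obj (regular b)).act_assoc
  middle_assoc := by
    have h := isLinear_homEv (evalAdjunct F)
    have h' := braiding_swap (F.obj (regular b)).X b'.X b.X
    rw [IsLinear] at h
    rw [evalAct, BraidedCategory.braiding_naturality_right_assoc, h, reassoc_of% h']
    simp

/-- The morphism of `C` underlying a morphism of right modules. -/
noncomputable def pointHom {M N : RightModule b'} (f : 𝟙_ C ⟶ homObj M N) : M.X ⟶ N.X :=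
  (ρ_ M.X).inv ≫ M.X ◁ f ≫ homEv M N

theorem whiskerLeft_ev_unit {M N : RightModule b'} (f : 𝟙_ C ⟶ homObj M N) :
    M.X ◁ f ≫ homEv M N = (ρ_ M.X).hom ≫ pointHom f := by
  rw [pointHom, Iso.hom_inv_id_assoc]

theorem act_pointHom {M N : RightModule b'} (f : 𝟙_ C ⟶ homObj M N) :
    M.act ≫ pointHom f = pointHom f ▷ b'.X ≫ N.act := by
  have h := isLinear_homEv f
  have h' := swap_unit M.X b'.X
  rw [IsLinear, whiskerLeft_ev_unit, comp_whiskerRight, Category.assoc, reassoc_of% h',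
    rightUnitor_naturality_assoc, cancel_epi] at h
  exact h

theorem pointHom_left {M N P : RightModule b'} {A : C} (f : 𝟙_ C ⟶ homObj M N)
    (g : A ⟶ homObj N P) : M.X ◁ ((λ_ A).inv ≫ (f ⊗ₘ g) ≫ homComp M N P) ≫ homEv M P =
      pointHom f ▷ A ≫ N.X ◁ g ≫ homEv N P := by
  rw [MonoidalCategory.whiskerLeft_comp, Category.assoc, homComp_ev', whiskerLeft_ev_unit]
  simp

theorem pointHom_right {M N P : RightModule b'} {A : C} (f : A ⟶ homObj M N)
    (g : 𝟙_ C ⟶ homObj N P) : M.X ◁ ((ρ_ A).inv ≫ (f ⊗ₘ g) ≫ homComp M N P) ≫ homEv M P =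
      (M.X ◁ f ≫ homEv M N) ≫ pointHom g := by
  rw [MonoidalCategory.whiskerLeft_comp, Category.assoc, homComp_ev', whiskerLeft_ev_unit,
    rightUnitor_naturality_assoc]
  simp

theorem pointHom_id (M : RightModule b') : pointHom (homId M) = 𝟙 M.X := by
  rw [pointHom, homId_ev, Iso.inv_hom_id]

theorem pointHom_comp {M N P : RightModule b'} (f : 𝟙_ C ⟶ homObj M N) (g : 𝟙_ C ⟶ homObj N P) :
    pointHom ((λ_ (𝟙_ C)).inv ≫ (f ⊗ₘ g) ≫ homComp M N P) = pointHom f ≫ pointHom g := by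
  rw [pointHom, pointHom_left, whiskerLeft_ev_unit, rightUnitor_naturality_assoc,
    Iso.inv_hom_id_assoc]

theorem evalAdjunct_naturality {F G : EnrichedFunctor C (RightModule b) (RightModule b')}
    (ξ : EnrichedTrans F G) :
    (λ_ b.X).inv ≫ (ξ.app (regular b) ⊗ₘ evalAdjunct G) ≫ homComp _ _ _ =
      (ρ_ b.X).inv ≫ (evalAdjunct F ⊗ₘ ξ.app (regular b)) ≫ homComp _ _ _ := by
  have h := ξ.naturality (regular b) (regular b)
  have h₂ := star_pre_right (leftMul b) (ξ.app (regular b)) (G.map (regular b) (regular b))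
  have h₃ := star_pre_left (leftMul b) (F.map (regular b) (regular b)) (ξ.app (regular b))
  change star (ξ.app (regular b)) (evalAdjunct G) = _ at h₂
  change star (evalAdjunct F) (ξ.app (regular b)) = _ at h₃
  change _ ≫ star (ξ.app (regular b)) (evalAdjunct G) =
    _ ≫ star (evalAdjunct F) (ξ.app (regular b))
  rw [h₂, h₃, ← leftUnitor_inv_naturality_assoc, ← rightUnitor_inv_naturality_assoc]
  exact congrArg (fun t => leftMul b ≫ t) h

/-- The morphism of bimodules `F(b_b) ⟶ G(b_b)` given by the component at `b_b` of a
transformation. -/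
noncomputable def evalHom {F G : EnrichedFunctor C (RightModule b) (RightModule b')}
    (ξ : EnrichedTrans F G) : evalBimod F ⟶ evalBimod G where
  hom := pointHom (ξ.app (regular b))
  left_act_hom := by
    change evalAct F ≫ pointHom (ξ.app (regular b)) =
      b.X ◁ pointHom (ξ.app (regular b)) ≫ evalAct G
    have h := congrArg (fun t => (F.obj (regular b)).X ◁ t ≫ homEv _ _) (evalAdjunct_naturality ξ)
    rw [pointHom_left, pointHom_right] at h
    rw [evalAct, evalAct, BraidedCategory.braiding_naturality_right_assoc, h]
    simp
  right_act_hom := act_pointHom _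

/-- The functor `F ↦ F(b_b)` of evaluation at the regular module, from `C`-enriched functors to
bimodules. -/
noncomputable def evalFunctor (b b' : Mon C) :
    EnrichedFunct C (RightModule b) (RightModule b') ⥤ Bimod b b' where
  obj F := evalBimod F.functor
  map ξ := evalHom ξ
  map_id _ := Bimod.hom_ext _ _ (pointHom_id _)
  map_comp ξ ζ := Bimod.hom_ext _ _ (pointHom_comp (ξ.app _) (ζ.app _))

end Evaluation

section Statement

variable {C : Type u} [Category.{v} C] [MonoidalCategory C] [SymmetricCategory C]
  [MonoidalClosed C]

variable (C) in
/-- The category of cocontinuous `C`-enriched functors `D ⥤ E`, as a full subcategory of the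
category of `C`-enriched functors. -/
abbrev CoconFunct (D : Type u₁) [EnrichedCategory C D] (E : Type u₂) [EnrichedCategory C E] :=
  ObjectProperty.FullSubcategory
    (fun F : EnrichedFunct C D E => IsCocontinuous.{w} F.functor)

variable (C) in
/-- The inclusion of the cocontinuous `C`-enriched functors into all `C`-enriched functors. -/
abbrev coconInclusion (D : Type u₁) [EnrichedCategory C D] (E : Type u₂) [EnrichedCategory C E] :
    CoconFunct.{w} C D E ⥤ EnrichedFunct C D E :=
  ObjectProperty.ι _

end Statement

end EnrichedEW

/-!
# Cocontinuous functors between categories of modules are tensor products with bimodules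

The proof shows that evaluation at `b_b`, restricted to cocontinuous functors, is fully faithful,
and that it has the functor `x ↦ - ⊗_b x` as a section up to isomorphism. Hence it is an equivalence
of categories, and `x ↦ - ⊗_b x` is isomorphic to its inverse. Exchanging the inverse for this
isomorphic functor gives the adjoint equivalence.

*Fully faithful.* The module `b_b` is dense in `Mod_b` (`isLanFrom_id_regular`): since evaluation at
the unit identifies `Mod_b(b_b, z)` with `z`, every module `z` is the colimit of `b_b`, weighted by
`Mod_b(b_b, z)`, over the full subcategory on `b_b`. This is a single weighted colimit indexed by a
`C`-category with one object, hence a small one for every choice of the universe, and a cocontinuous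
functor `F` preserves it (`IsCocontinuous.isLanFrom`). So `F` is the left Kan extension of its
restriction to `b_b`, and transformations out of `F` correspond to morphisms out of `F(b_b)` which
commute with `Mod_b(b_b, b_b) ≅ b` (`IsLanFrom.trans_ext`, `IsLanFrom.exists_trans`).

*Section.* The functor `- ⊗_b x` has the enriched right adjoint `Mod_b'(x, -)`, so that it is
cocontinuous (`isCocontinuous_of_rightAdjoint`, `isCocontinuous_tensorEnrichedFunctor`), and the
unit and the left action give an isomorphism of bimodules `b ⊗_b x ≅ x` (`tensorEvalIso`).
-/

namespace EnrichedEW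

/-! ### Left Kan extension from a single object -/

section SingleObject

variable {C : Type u} [Category.{v} C] [MonoidalCategory C]
  {D : Type u₁} [EnrichedCategory C D] {E : Type u₂} [EnrichedCategory C E]

theorem star_assoc_symm {X Y Z T : D} {A B A' : C} (f : A ⟶ (X ⟶[C] Y))
    (g : B ⟶ (Y ⟶[C] Z)) (h : A' ⟶ (Z ⟶[C] T)) :
    star f (star g h) = (α_ A B A').inv ≫ star (star f g) h := by
  rw [star_assoc, Iso.inv_hom_id_assoc]

/-- The `C`-enriched functor `F` is, at every object `Z`, the left Kan extension of its restriction
to the full subcategory of `D` on the single object `X`: the hom-object `E(F Z, Y)` represents the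
families `D(X, Z) ⟶ E(F X, Y)` which are linear over the monoid `D(X, X)`. For the identity functor
this says that `X` is dense in `D`. -/
def IsLanFrom (F : EnrichedFunctor C D E) (X : D) : Prop :=
  ∀ (Z : D) (A : C) (Y : E) (φ : (X ⟶[C] Z) ⊗ A ⟶ (F.obj X ⟶[C] Y)),
    star (F.map X X) φ = (α_ _ _ _).inv ≫ eComp C X X Z ▷ A ≫ φ →
      ∃! h : A ⟶ (F.obj Z ⟶[C] Y), star (F.map X Z) h = φ

variable {F G : EnrichedFunctor C D E} {X : D}

theorem star_map_eComp (F : EnrichedFunctor C D E) (X Y Z : D) :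
    eComp C X Y Z ≫ F.map X Z = star (F.map X Y) (F.map Y Z) :=
  F.map_comp X Y Z

theorem IsLanFrom.hom_ext (hF : IsLanFrom F X) {Z : D} {A : C} {Y : E}
    {h h' : A ⟶ (F.obj Z ⟶[C] Y)} (w : star (F.map X Z) h = star (F.map X Z) h') : h = h' := by
  refine (hF Z A Y (star (F.map X Z) h') ?_).unique w rfl
  rw [star_assoc_symm, ← star_map_eComp, star_pre_left]

theorem EnrichedTrans.star_naturality (ξ : EnrichedTrans F G) (X Y : D) :
    star (ξ.app X) (G.map X Y) =
      (λ_ (X ⟶[C] Y)).hom ≫ (ρ_ (X ⟶[C] Y)).inv ≫ star (F.map X Y) (ξ.app Y) := by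
  rw [← cancel_epi (λ_ _).inv]
  simpa [star] using ξ.naturality X Y

/-- A transformation out of a left Kan extension is determined by its component at the object from
which the functor is extended. -/
theorem IsLanFrom.trans_ext (hF : IsLanFrom F X) {ξ ζ : EnrichedTrans F G}
    (h : ξ.app X = ζ.app X) : ξ = ζ := by
  refine EnrichedTrans.ext (funext fun Z => hF.hom_ext ?_)
  rw [← cancel_epi (ρ_ _).inv, ← cancel_epi (λ_ _).hom, ← ξ.star_naturality,
    ← ζ.star_naturality, h]

/-- A morphism `F X ⟶ G X` which commutes with the actions of the endomorphism monoid `D(X, X)`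
extends to a transformation out of the left Kan extension `F`. -/
theorem IsLanFrom.exists_trans (hF : IsLanFrom F X) (g : 𝟙_ C ⟶ (F.obj X ⟶[C] G.obj X))
    (hg : star g (G.map X X) = (λ_ _).hom ≫ (ρ_ _).inv ≫ star (F.map X X) g) :
    ∃ ξ : EnrichedTrans F G, ξ.app X = g := by
  -- The component at `Z` classifies the family `f ↦ g ≫ G f` for `f` in `D(X, Z)`.
  have nat : ∀ Z, star (F.map X X) ((ρ_ (X ⟶[C] Z)).hom ≫ (λ_ _).inv ≫ star g (G.map X Z)) =
      (α_ _ _ _).inv ≫ eComp C X X Z ▷ 𝟙_ C ≫ (ρ_ _).hom ≫ (λ_ _).inv ≫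
        star g (G.map X Z) := by
    intro Z
    have hg' : star (F.map X X) g = (ρ_ _).hom ≫ (λ_ _).inv ≫ star g (G.map X X) := by
      rw [hg]; simp
    rw [← Category.assoc (ρ_ _).hom, star_pre_right, star_assoc_symm, hg',
      ← Category.assoc (ρ_ _).hom, star_pre_left, star_assoc, ← star_map_eComp,
      star_pre_right]
    simp only [← Category.assoc]
    congr 1
    simp
  choose t ht using fun Z => (hF Z _ _ _ (nat Z)).exists
  have ht' : ∀ Z, star (F.map X Z) (t Z) = (ρ_ (X ⟶[C] Z)).hom ≫ (λ_ _).inv ≫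
      star g (G.map X Z) := ht
  have htX : t X = g := hF.hom_ext (by rw [ht', hg]; simp)
  refine ⟨⟨t, fun Y Z => ?_⟩, htX⟩
  apply hF.hom_ext
  change star (F.map X Y) ((λ_ _).inv ≫ star (t Y) (G.map Y Z)) =
    star (F.map X Y) ((ρ_ _).inv ≫ star (F.map Y Z) (t Z))
  rw [star_pre_right, star_pre_right, star_assoc_symm, star_assoc_symm, ht',
    ← star_map_eComp, star_pre_left (eComp C X Y Z), ht',
    ← Category.assoc (ρ_ (X ⟶[C] Y)).hom, star_pre_left, star_assoc, ← star_map_eComp,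
    star_pre_right]
  simp only [← Category.assoc]
  congr 1
  simp

end SingleObject

/-! ### Weighted colimits over the full subcategory on one object -/

section InternalHom

variable {C : Type u} [Category.{v} C] [MonoidalCategory C] [MonoidalClosed C]

theorem comp_uncurry_curry {A B P Q R : C} (f : P ⊗ A ⟶ Q) (g : Q ⊗ B ⟶ R) :
    P ◁ ((MonoidalClosed.curry f ⊗ₘ MonoidalClosed.curry g) ≫ MonoidalClosed.comp P Q R) ≫
      (ihom.ev P).app R = (α_ _ _ _).inv ≫ f ▷ B ≫ g := by
  rw [← MonoidalClosed.uncurry_eq, MonoidalClosed.uncurry_natural_left, MonoidalClosed.comp_eq,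
    MonoidalClosed.uncurry_curry, MonoidalClosed.compTranspose_eq, MonoidalCategory.tensorHom_def,
    MonoidalCategory.whiskerLeft_comp, Category.assoc, associator_inv_naturality_right_assoc,
    whisker_exchange_assoc, associator_inv_naturality_middle_assoc, ← comp_whiskerRight_assoc,
    MonoidalClosed.whiskerLeft_curry_ihom_ev_app]
  exact congrArg (fun t => (α_ _ _ _).inv ≫ f ▷ B ≫ t)
    (MonoidalClosed.whiskerLeft_curry_ihom_ev_app _ _ g)

end InternalHom

section Cocontinuity

variable {C : Type u} [Category.{v} C] [MonoidalCategory C] [SymmetricCategory C]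
  {D : Type u₁} [EnrichedCategory C D] {E : Type u₂} [EnrichedCategory C E]

/-- The index category of the weighted colimit which exhibits a left Kan extension from a single
object `X`: it has one object, whose endomorphism monoid is `D(X, X)`. -/
@[nolint unusedArguments]
def FullSubcategoryOn (_ : D) : Type w := PUnit.{w + 1}

instance FullSubcategoryOn.enrichedCategory (X : D) :
    EnrichedCategory C (FullSubcategoryOn.{w} X) where
  Hom _ _ := X ⟶[C] X
  id _ := eId C X
  comp _ _ _ := eComp C X X X
  id_comp _ _ := e_id_comp C X X
  comp_id _ _ := e_comp_id C X X
  assoc _ _ _ _ := e_assoc C X X X X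

variable (C) in
/-- The inclusion of the full subcategory on a single object. -/
def FullSubcategoryOn.inclusion (X : D) : EnrichedFunctor C (FullSubcategoryOn.{w} X) D where
  obj _ := X
  map _ _ := 𝟙 (X ⟶[C] X)
  map_id _ := Category.comp_id _
  map_comp _ _ _ := by
    refine (Category.comp_id (eComp C X X X)).trans ?_
    exact ((congrArg (· ≫ eComp C X X X) (id_tensorHom_id (X ⟶[C] X) (X ⟶[C] X))).trans
      (Category.id_comp _)).symm

variable [MonoidalClosed C]

theorem curry_unit_eComp (X Z : D) :
    eId C X ≫ MonoidalClosed.curry ((β_ (X ⟶[C] Z) (X ⟶[C] X)).hom ≫ eComp C X X Z) =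
      MonoidalClosed.id (X ⟶[C] Z) := by
  apply MonoidalClosed.uncurry_injective
  have h := eId_star (𝟙 (X ⟶[C] Z))
  rw [star, MonoidalCategory.tensorHom_id, Category.comp_id] at h
  rw [MonoidalClosed.uncurry_natural_left, MonoidalClosed.uncurry_curry,
    BraidedCategory.braiding_naturality_right_assoc, MonoidalClosed.id_eq,
    MonoidalClosed.uncurry_curry, h]
  simp

/-- The functoriality of `D(-, Z)` on the endomorphisms of `X`, in terms of the internal hom. -/
theorem curry_comp_eComp (X Z : D) :
    ((β_ _ _).hom ≫ eComp C X X X) ≫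
        MonoidalClosed.curry ((β_ (X ⟶[C] Z) (X ⟶[C] X)).hom ≫ eComp C X X Z) =
      (MonoidalClosed.curry ((β_ (X ⟶[C] Z) (X ⟶[C] X)).hom ≫ eComp C X X Z) ⊗ₘ
        MonoidalClosed.curry ((β_ (X ⟶[C] Z) (X ⟶[C] X)).hom ≫ eComp C X X Z)) ≫
          MonoidalClosed.comp _ _ _ := by
  apply MonoidalClosed.uncurry_injective
  have h := star_assoc (𝟙 (X ⟶[C] X)) (𝟙 (X ⟶[C] X)) (𝟙 (X ⟶[C] Z))
  simp only [star, MonoidalCategory.tensorHom_id, MonoidalCategory.id_tensorHom,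
    id_whiskerRight, Category.id_comp] at h
  have h' := braiding_three' (X ⟶[C] Z) (X ⟶[C] X) (X ⟶[C] X)
  rw [MonoidalClosed.uncurry_natural_left, MonoidalClosed.uncurry_curry,
    MonoidalClosed.uncurry_eq, comp_uncurry_curry,
    BraidedCategory.braiding_naturality_right_assoc, comp_whiskerRight, Category.assoc,
    comp_whiskerRight, Category.assoc, BraidedCategory.braiding_naturality_left_assoc, h,
    ← BraidedCategory.braiding_naturality_right_assoc, ← reassoc_of% h',
    ← MonoidalCategory.whiskerLeft_comp_assoc, SymmetricCategory.symmetry,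
    MonoidalCategory.whiskerLeft_id, Category.id_comp]

variable (C) in
/-- The representable presheaf `D(-, Z)`, restricted to the full subcategory on `X`. -/
def homWeight (X Z : D) : EnrichedFunctor C (FullSubcategoryOn.{w} X)ᵒᵖ C where
  obj _ := X ⟶[C] Z
  map _ _ := MonoidalClosed.curry ((β_ (X ⟶[C] Z) (X ⟶[C] X)).hom ≫ eComp C X X Z)
  map_id _ := curry_unit_eComp X Z
  map_comp _ _ _ := curry_comp_eComp X Z

theorem weightAct_homWeight (X Z : D) (i j : FullSubcategoryOn.{w} X) :
    weightAct (homWeight C X Z) i j = eComp C X X Z := by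
  have h : (β_ (X ⟶[C] X) (X ⟶[C] Z)).hom ≫ MonoidalClosed.uncurry (MonoidalClosed.curry
      ((β_ (X ⟶[C] Z) (X ⟶[C] X)).hom ≫ eComp C X X Z)) = eComp C X X Z := by
    rw [MonoidalClosed.uncurry_curry, SymmetricCategory.symmetry_assoc]
  exact h

variable (C) in
/-- The cocone which exhibits `Z` as the colimit of `X` weighted by `D(X, Z)`, if `X` is dense. -/
def densityCocone (X Z : D) :
    WeightedCocone (homWeight.{w} C X Z) (FullSubcategoryOn.inclusion C X) where
  pt := Z
  leg _ := 𝟙 (X ⟶[C] Z)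
  naturality i j := by
    rw [weightAct_homWeight]
    change (𝟙 _ ⊗ₘ 𝟙 _) ≫ eComp C X X Z = eComp C X X Z ≫ 𝟙 _
    simp

theorem isNaturalFamily_homWeight_iff (F : EnrichedFunctor C D E) {X Z : D} {A : C} {Y : E}
    (φ : FullSubcategoryOn.{w} X → ((X ⟶[C] Z) ⊗ A ⟶ (F.obj X ⟶[C] Y))) :
    IsNaturalFamily (homWeight C X Z) ((FullSubcategoryOn.inclusion C X).comp C F) A Y φ ↔
      ∀ i j, star (F.map X X) (φ j) = (α_ _ _ _).inv ≫ eComp C X X Z ▷ A ≫ φ i := by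
  refine forall_congr' fun i => forall_congr' fun j => ?_
  rw [weightAct_homWeight]
  change star (𝟙 _ ≫ F.map X X) (φ j) = _ ↔ _
  rw [Category.id_comp]
  rfl

theorem densityCocone_map_leg (F : EnrichedFunctor C D E) (X Z : D)
    (j : FullSubcategoryOn.{w} X) : ((densityCocone C X Z).map F).leg j = F.map X Z :=
  Category.id_comp (F.map X Z)

theorem isColimit_densityCocone_map_iff (F : EnrichedFunctor C D E) (X Z : D) :
    ((densityCocone.{w} C X Z).map F).IsColimit ↔
      ∀ (A : C) (Y : E) (φ : (X ⟶[C] Z) ⊗ A ⟶ (F.obj X ⟶[C] Y)),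
        star (F.map X X) φ = (α_ _ _ _).inv ≫ eComp C X X Z ▷ A ≫ φ →
          ∃! h : A ⟶ (F.obj Z ⟶[C] Y), star (F.map X Z) h = φ := by
  have leg : ∀ {A : C} {Y : E} (φ : FullSubcategoryOn.{w} X → _) (h : A ⟶ (F.obj Z ⟶[C] Y)),
      (∀ j, (((densityCocone.{w} C X Z).map F).leg j ⊗ₘ h) ≫ eComp C _ _ Y = φ j) ↔
        ∀ j, star (F.map X Z) h = φ j := by
    intro A Y φ h
    refine forall_congr' fun j => ?_
    rw [densityCocone_map_leg]
    rfl
  constructor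
  · intro H A Y φ hφ
    obtain ⟨h, h₁, h₂⟩ := H A Y (fun _ => φ)
      ((isNaturalFamily_homWeight_iff F _).2 fun _ _ => hφ)
    exact ⟨h, (leg (fun _ => φ) h).1 h₁ PUnit.unit,
      fun h' w => h₂ h' ((leg (fun _ => φ) h').2 fun _ => w)⟩
  · intro H A Y φ hφ
    obtain ⟨h, h₁, h₂⟩ := H A Y (φ PUnit.unit)
      ((isNaturalFamily_homWeight_iff F φ).1 hφ PUnit.unit PUnit.unit)
    exact ⟨h, (leg φ h).2 fun _ => h₁, fun h' w => h₂ h' ((leg φ h').1 w PUnit.unit)⟩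

theorem WeightedCocone.isColimit_map_id_iff {J : Type w} [EnrichedCategory C J]
    {W : EnrichedFunctor C Jᵒᵖ C} {G : EnrichedFunctor C J D} (c : WeightedCocone W G) :
    (c.map (EnrichedFunctor.id C D)).IsColimit ↔ c.IsColimit := by
  simp only [WeightedCocone.IsColimit, IsNaturalFamily, WeightedCocone.map, EnrichedFunctor.comp,
    EnrichedFunctor.id, Category.comp_id]

/-- A cocontinuous functor is the left Kan extension of its restriction to a dense object. -/
theorem IsCocontinuous.isLanFrom {F : EnrichedFunctor C D E} (hF : IsCocontinuous.{w} F) {X : D}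
    (hX : IsLanFrom (EnrichedFunctor.id C D) X) : IsLanFrom F X := by
  intro Z
  refine (isColimit_densityCocone_map_iff.{w} F X Z).1 (hF _ _ _ _ ?_)
  rw [← WeightedCocone.isColimit_map_id_iff]
  exact (isColimit_densityCocone_map_iff.{w} (EnrichedFunctor.id C D) X Z).2 (hX Z)

/-- A `C`-enriched functor with a right adjoint is cocontinuous. The adjoint is given by its values
and by the counit, such that transposition is a bijection on generalized elements. -/
theorem isCocontinuous_of_rightAdjoint (F : EnrichedFunctor C D E) (R : E → D)
    (ε : ∀ Y, 𝟙_ C ⟶ (F.obj (R Y) ⟶[C] Y))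
    (hε : ∀ (Z : D) (Y : E) (A : C), Function.Bijective
      fun g : A ⟶ (Z ⟶[C] R Y) => (ρ_ A).inv ≫ star (g ≫ F.map Z (R Y)) (ε Y)) :
    IsCocontinuous.{w} F := by
  intro J _ W G c hc A Y φ hφ
  have tr_comp : ∀ {Z Z' : D} {A B : C} (f : A ⟶ (Z ⟶[C] Z')) (g : B ⟶ (Z' ⟶[C] R Y)),
      (ρ_ _).inv ≫ star (star f g ≫ F.map Z (R Y)) (ε Y) =
        star (f ≫ F.map Z Z') ((ρ_ _).inv ≫ star (g ≫ F.map Z' (R Y)) (ε Y)) := by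
    intro Z Z' A B f g
    rw [star_map, star_assoc, star_pre_right]
    simp
  have tr_pre : ∀ {Z : D} {A B : C} (p : A ⟶ B) (g : B ⟶ (Z ⟶[C] R Y)),
      (ρ_ _).inv ≫ star ((p ≫ g) ≫ F.map Z (R Y)) (ε Y) =
        p ≫ (ρ_ _).inv ≫ star (g ≫ F.map Z (R Y)) (ε Y) := by
    intro Z A B p g
    rw [Category.assoc, star_pre_left, rightUnitor_inv_naturality_assoc]
  choose ψ hψ using fun j => (hε (G.obj j) Y _).2 (φ j)
  simp only at hψ
  have nat : IsNaturalFamily W G A (R Y) ψ := by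
    intro i j
    apply (hε _ Y _).1
    change (ρ_ _).inv ≫ star (star (G.map i j) (ψ j) ≫ F.map _ _) (ε Y) =
      (ρ_ _).inv ≫ star (((α_ _ _ _).inv ≫ weightAct W i j ▷ A ≫ ψ i) ≫ F.map _ _) (ε Y)
    rw [tr_comp, tr_pre, tr_pre, hψ, hψ]
    exact hφ i j
  obtain ⟨h, h₁, h₂⟩ := hc A (R Y) ψ nat
  refine ⟨(ρ_ A).inv ≫ star (h ≫ F.map _ _) (ε Y), fun j => ?_, fun h' w => ?_⟩
  · refine (tr_comp (c.leg j) h).symm.trans ?_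
    rw [← hψ]
    exact congrArg (fun t => (ρ_ _).inv ≫ star (t ≫ F.map _ _) (ε Y)) (h₁ j)
  · obtain ⟨k, rfl⟩ := (hε _ Y _).2 h'
    have : k = h := h₂ k fun j => (hε _ Y _).1 <| by
      refine (tr_comp (c.leg j) k).trans ?_
      exact (w j).trans (hψ j).symm
    subst this
    rfl

end Cocontinuity

/-! ### Density of the regular module -/

section SwapSymm

variable {C : Type u} [Category.{v} C] [MonoidalCategory C] [SymmetricCategory C]

theorem swap_swap (M A B : C) : swap M A B ≫ swap M B A = 𝟙 _ := by
  simp only [swap, Category.assoc, Iso.inv_hom_id_assoc]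
  rw [← MonoidalCategory.whiskerLeft_comp_assoc, SymmetricCategory.symmetry]
  simp

theorem braiding_associator_braiding (M B A : C) :
    (β_ M A).hom ▷ B ≫ (α_ A M B).hom ≫ (β_ A (M ⊗ B)).hom = swap M A B := by
  have h := braiding_swap M B A
  have h' : (α_ A M B).hom ≫ (β_ A (M ⊗ B)).hom = (β_ A M).hom ▷ B ≫ swap M A B := by
    rw [← h]
    simp only [Category.assoc]
    rw [swap_swap, Category.comp_id]
  rw [h', ← comp_whiskerRight_assoc, SymmetricCategory.symmetry]
  simp

theorem braiding_tensor_swap (M B W : C) :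
    (β_ (M ⊗ B) W).hom ≫ (α_ W M B).inv = swap M B W ≫ (β_ M W).hom ▷ B := by
  simp [swap, BraidedCategory.braiding_tensor_left_hom]

end SwapSymm

section Density

open MonoidalClosed MonObj RightModule

variable {C : Type u} [Category.{v} C] [MonoidalCategory C] [SymmetricCategory C] {b : Mon C}

theorem RightModule.IsLinear.whiskerRight_act {M N : RightModule b} {A : C} {f : M.X ⊗ A ⟶ N.X}
    (hf : IsLinear f) : f ▷ b.X ≫ N.act = swap M.X A b.X ≫ M.act ▷ A ≫ f := by
  rw [IsLinear] at hf
  rw [hf, ← Category.assoc (swap _ _ _), swap_swap, Category.id_comp]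

theorem isLinear_braiding_act (z : RightModule b) :
    IsLinear (M := regular b) (N := z) ((β_ b.X z.X).hom ≫ z.act) := by
  change μ[b.X] ▷ z.X ≫ (β_ b.X z.X).hom ≫ z.act =
    swap b.X b.X z.X ≫ ((β_ b.X z.X).hom ≫ z.act) ▷ b.X ≫ z.act
  rw [BraidedCategory.braiding_naturality_left_assoc, comp_whiskerRight, Category.assoc,
    z.act_assoc, BraidedCategory.braiding_tensor_left_hom]
  simp [swap]

variable [MonoidalClosed C] [HasEqualizers C]

/-- Composition in the enriched category of modules on generalized elements of the hom-objects. It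
is `star`, with the hom-objects in the form `homObj`. -/
noncomputable def homStar {M N P : RightModule b} {A B : C} (f : A ⟶ homObj M N)
    (g : B ⟶ homObj N P) : A ⊗ B ⟶ homObj M P :=
  (f ⊗ₘ g) ≫ homComp M N P

theorem homStar_ev {M N P : RightModule b} {A B : C} (f : A ⟶ homObj M N) (g : B ⟶ homObj N P) :
    M.X ◁ homStar f g ≫ homEv M P =
      (α_ _ _ _).inv ≫ (M.X ◁ f ≫ homEv M N) ▷ B ≫ N.X ◁ g ≫ homEv N P :=
  homComp_ev' f g

theorem homStar_pre_left {M N P : RightModule b} {A A' B : C} (p : A' ⟶ A) (f : A ⟶ homObj M N)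
    (g : B ⟶ homObj N P) : homStar (p ≫ f) g = p ▷ B ≫ homStar f g :=
  star_pre_left (X := M) (Y := N) (Z := P) p f g

theorem homStar_pre_right {M N P : RightModule b} {A B B' : C} (q : B' ⟶ B) (f : A ⟶ homObj M N)
    (g : B ⟶ homObj N P) : homStar f (q ≫ g) = A ◁ q ≫ homStar f g :=
  star_pre_right (X := M) (Y := N) (Z := P) q f g

theorem homStar_assoc {M N P Q : RightModule b} {A B A' : C} (f : A ⟶ homObj M N)
    (g : B ⟶ homObj N P) (h : A' ⟶ homObj P Q) :
    homStar (homStar f g) h = (α_ A B A').hom ≫ homStar f (homStar g h) :=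
  star_assoc (X := M) (Y := N) (Z := P) (T := Q) f g h

/-- The morphism `z ⟶ Mod_b(b_b, z)` which sends an element to the multiplication of this element
by elements of `b`. -/
noncomputable def ofElement (z : RightModule b) : z.X ⟶ homObj (regular b) z :=
  homLift _ (isLinear_braiding_act z)

theorem ofElement_ev (z : RightModule b) :
    b.X ◁ ofElement z ≫ homEv (regular b) z = (β_ b.X z.X).hom ≫ z.act :=
  homLift_ev _ (isLinear_braiding_act z)

/-- The evaluation `Mod_b(b_b, z) ⟶ z` at the unit of `b`. -/
noncomputable def evOne (z : RightModule b) : homObj (regular b) z ⟶ z.X :=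
  (λ_ _).inv ≫ η[b.X] ▷ _ ≫ homEv (regular b) z

theorem comp_evOne {z : RightModule b} {A : C} (f : A ⟶ homObj (regular b) z) :
    f ≫ evOne z = (λ_ A).inv ≫ η[b.X] ▷ A ≫ b.X ◁ f ≫ homEv (regular b) z := by
  rw [evOne, leftUnitor_inv_naturality_assoc, whisker_exchange_assoc]

theorem ofElement_evOne (z : RightModule b) : ofElement z ≫ evOne z = 𝟙 z.X := by
  rw [comp_evOne, ofElement_ev, BraidedCategory.braiding_naturality_left_assoc, z.act_one]
  simp

/-- A module morphism out of `b_b` is determined by its value at the unit. -/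
theorem evOne_ofElement (z : RightModule b) : evOne z ≫ ofElement z = 𝟙 _ := by
  apply homObj_ext
  have h := (isLinear_homEv' (regular b) z).whiskerRight_act
  change homEv (regular b) z ▷ b.X ≫ z.act =
    swap b.X _ b.X ≫ μ[b.X] ▷ _ ≫ homEv (regular b) z at h
  have e : (β_ b.X (homObj (regular b) z)).hom ≫ (λ_ _).inv ▷ b.X ≫ swap (𝟙_ C) _ b.X =
      (λ_ b.X).inv ▷ _ := by
    rw [← braiding_associator_braiding]
    rw [← comp_whiskerRight_assoc, braiding_tensorUnit_left, Iso.inv_hom_id_assoc]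
    have e : (ρ_ (homObj (regular b) z)).inv ▷ b.X ≫ (α_ _ _ _).hom = _ ◁ (λ_ b.X).inv := by
      monoidal
    rw [reassoc_of% e, BraidedCategory.braiding_naturality_right,
      SymmetricCategory.symmetry_assoc]
  rw [MonoidalCategory.whiskerLeft_comp, Category.assoc]
  change b.X ◁ evOne z ≫ b.X ◁ ofElement z ≫ homEv (regular b) z =
    b.X ◁ 𝟙 _ ≫ homEv (regular b) z
  rw [ofElement_ev, BraidedCategory.braiding_naturality_right_assoc, evOne, comp_whiskerRight,
    comp_whiskerRight, Category.assoc, Category.assoc, h, ← Category.assoc (η[b.X] ▷ _ ▷ _),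
    swap_nat_left, Category.assoc, ← comp_whiskerRight_assoc (η[b.X] ▷ _), MonObj.one_mul,
    reassoc_of% e, ← comp_whiskerRight_assoc]
  simp

theorem whiskerLeft_homEv_regular {z : RightModule b} {A : C} (f : A ⟶ homObj (regular b) z) :
    b.X ◁ f ≫ homEv (regular b) z = (β_ _ _).hom ≫ (f ≫ evOne z) ▷ b.X ≫ z.act := by
  rw [← BraidedCategory.braiding_naturality_right_assoc, ← ofElement_ev,
    ← MonoidalCategory.whiskerLeft_comp_assoc, Category.assoc, evOne_ofElement, Category.comp_id]

theorem homStar_evOne {y z : RightModule b} {A B : C} (f : A ⟶ homObj (regular b) z)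
    (h : B ⟶ homObj z y) :
    homStar f h ≫ evOne y = (f ≫ evOne z) ▷ B ≫ z.X ◁ h ≫ homEv z y := by
  rw [comp_evOne, comp_evOne]
  have e := homStar_ev f h
  change b.X ◁ homStar f h ≫ _ = (α_ b.X A B).inv ≫ (b.X ◁ f ≫ _) ▷ B ≫ _ at e
  rw [e]
  simp only [comp_whiskerRight, Category.assoc]
  rw [associator_inv_naturality_left_assoc, leftUnitor_tensor_inv]
  simp

/-- The family `ofElement z` intertwines the action of `b` on `z` with precomposition with left
multiplications. -/
theorem act_ofElement (z : RightModule b) :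
    z.act ≫ ofElement z = (β_ z.X b.X).hom ≫ homStar (leftMul b) (ofElement z) := by
  have h : (z.act ≫ ofElement z) ≫ evOne z =
      ((β_ z.X b.X).hom ≫ homStar (leftMul b) (ofElement z)) ≫ evOne z := by
    -- `leftMul b` is `ofElement (regular b)` by definition.
    have h₁ : leftMul b ≫ evOne (regular b) = 𝟙 b.X := ofElement_evOne (regular b)
    rw [Category.assoc, Category.assoc, ofElement_evOne, homStar_evOne, h₁, id_whiskerRight]
    change _ = (β_ z.X b.X).hom ≫ 𝟙 _ ≫ b.X ◁ ofElement z ≫ homEv (regular b) z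
    rw [ofElement_ev]
    simp
  have h' := congrArg (· ≫ ofElement z) h
  simpa [evOne_ofElement] using h'

/-- A family `Mod_b(b_b, z) ⊗ a ⟶ Mod_b(b_b, y)` which is linear over the endomorphism monoid of
`b_b` is given by a family `z ⊗ a ⟶ y` of module morphisms. -/
theorem isLinear_of_regular {y z : RightModule b} {A : C}
    {φ : homObj (regular b) z ⊗ A ⟶ homObj (regular b) y}
    (hφ : homStar (𝟙 (homObj (regular b) (regular b))) φ =
      (α_ _ _ _).inv ≫ homComp (regular b) (regular b) z ▷ A ≫ φ) :
    IsLinear (M := z) (N := y) (ofElement z ▷ A ≫ φ ≫ evOne y) := by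
  have hφ' : homComp (regular b) (regular b) z ▷ A ≫ φ =
      (α_ _ _ _).hom ≫ homStar (𝟙 (homObj (regular b) (regular b))) φ := by
    rw [hφ, Iso.hom_inv_id_assoc]
  have h₁ : homStar (leftMul b) (ofElement z) ▷ A ≫ φ =
      (α_ _ _ _).hom ≫ homStar (leftMul b) (ofElement z ▷ A ≫ φ) := by
    have e : homStar (leftMul b) (ofElement z ▷ A ≫ φ) =
        leftMul b ▷ _ ≫ _ ◁ (ofElement z ▷ A) ≫ homStar (𝟙 _) φ := by
      rw [← homStar_pre_right, ← homStar_pre_left, Category.comp_id]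
    rw [e, homStar, comp_whiskerRight, Category.assoc, hφ', MonoidalCategory.tensorHom_def]
    simp
  have h₂ : leftMul b ≫ evOne (regular b) = 𝟙 b.X := ofElement_evOne (regular b)
  rw [IsLinear, ← comp_whiskerRight_assoc, act_ofElement, comp_whiskerRight, Category.assoc,
    reassoc_of% h₁, homStar_evOne, h₂, id_whiskerRight]
  have h₃ := whiskerLeft_homEv_regular (ofElement z ▷ A ≫ φ)
  have h₄ := braiding_associator_braiding z.X A b.X
  change _ ≫ _ ≫ 𝟙 _ ≫ b.X ◁ (ofElement z ▷ A ≫ φ) ≫ homEv (regular b) y = _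
  rw [h₃, Category.id_comp, reassoc_of% h₄, Category.assoc]

/-- The density of the regular module, with the hom-objects in the form `homObj`. -/
theorem existsUnique_homStar_regular {y z : RightModule b} {A : C}
    {φ : homObj (regular b) z ⊗ A ⟶ homObj (regular b) y}
    (hφ : homStar (𝟙 (homObj (regular b) (regular b))) φ =
      (α_ _ _ _).inv ≫ homComp (regular b) (regular b) z ▷ A ≫ φ) :
    ∃! h : A ⟶ homObj z y, homStar (𝟙 (homObj (regular b) z)) h = φ := by
  have hlin := isLinear_of_regular hφ
  have hev : ∀ h : A ⟶ homObj z y, homStar (𝟙 (homObj (regular b) z)) h ≫ evOne y =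
      evOne z ▷ A ≫ z.X ◁ h ≫ homEv z y := fun h => by rw [homStar_evOne, Category.id_comp]
  refine ⟨homLift _ hlin, ?_, fun h w => ?_⟩
  · have h₁ : homStar (𝟙 (homObj (regular b) z)) (homLift _ hlin) ≫ evOne y = φ ≫ evOne y := by
      rw [hev, homLift_ev, ← comp_whiskerRight_assoc, evOne_ofElement, id_whiskerRight,
        Category.id_comp]
    simpa [evOne_ofElement] using congrArg (· ≫ ofElement y) h₁
  · apply homObj_ext
    have w' : homStar (𝟙 (homObj (regular b) z)) h = φ := w
    rw [homLift_ev, ← w', hev, ← comp_whiskerRight_assoc, ofElement_evOne, id_whiskerRight,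
      Category.id_comp]

variable (b) in
/-- The regular module is dense. -/
theorem isLanFrom_id_regular :
    IsLanFrom (EnrichedFunctor.id C (RightModule b)) (regular b) :=
  fun z _ y _ hφ => existsUnique_homStar_regular (y := y) (z := z) hφ

end Density

/-! ### The right adjoint of tensoring with a bimodule -/

section Adjoint

open MonoidalClosed MonObj RightModule

variable {C : Type u} [Category.{v} C] [MonoidalCategory C] [SymmetricCategory C]
  {b b' : Mon C}

/-- The right module underlying a bimodule. -/
abbrev rightModule (x : Bimod b b') : RightModule b' where
  X := x.X
  act := x.actRight
  act_one := x.actRight_one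
  act_assoc := x.right_assoc

theorem isLinear_actLeft (x : Bimod b b') :
    IsLinear (M := rightModule x) (N := rightModule x) ((β_ x.X b.X).hom ≫ x.actLeft) := by
  change x.actRight ▷ b.X ≫ (β_ x.X b.X).hom ≫ x.actLeft =
    swap x.X b'.X b.X ≫ ((β_ x.X b.X).hom ≫ x.actLeft) ▷ b'.X ≫ x.actRight
  rw [BraidedCategory.braiding_naturality_left_assoc, comp_whiskerRight, Category.assoc,
    x.middle_assoc, BraidedCategory.braiding_tensor_left_hom]
  simp [swap]

/-- A family `z ⊗ x ⟶ y` indexed by `A` which is linear over `b'` gives a family `x ⟶ y` of module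
morphisms indexed by `z ⊗ A`. -/
theorem isLinear_swap_right {z : RightModule b} {x : Bimod b b'} {y : RightModule b'} {A : C}
    {F : (z.X ⊗ x.X) ⊗ A ⟶ y.X}
    (hF : ((α_ z.X x.X b'.X).hom ≫ z.X ◁ x.actRight) ▷ A ≫ F =
      swap (z.X ⊗ x.X) b'.X A ≫ F ▷ b'.X ≫ y.act) :
    IsLinear (M := rightModule x) (N := y) ((β_ x.X (z.X ⊗ A)).hom ≫ swap z.X A x.X ≫ F) := by
  have hF' : (z.X ◁ x.actRight) ▷ A ≫ F =
      (α_ z.X x.X b'.X).inv ▷ A ≫ swap (z.X ⊗ x.X) b'.X A ≫ F ▷ b'.X ≫ y.act := by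
    rw [← hF, ← comp_whiskerRight_assoc, Iso.inv_hom_id_assoc]
  have h₁ := swap_tensor_right z.X A x.X b'.X
  have h₂ := braiding_tensor_swap x.X b'.X (z.X ⊗ A)
  have h₃ := swap_swap (z.X ⊗ x.X) A b'.X
  change x.actRight ▷ (z.X ⊗ A) ≫ (β_ x.X (z.X ⊗ A)).hom ≫ swap z.X A x.X ≫ F =
    swap x.X b'.X (z.X ⊗ A) ≫ ((β_ x.X (z.X ⊗ A)).hom ≫ swap z.X A x.X ≫ F) ▷ b'.X ≫ y.act
  rw [BraidedCategory.braiding_naturality_left_assoc, ← Category.assoc (_ ◁ x.actRight),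
    swap_nat_right, Category.assoc, hF', ← reassoc_of% h₁, reassoc_of% h₃, reassoc_of% h₂]
  simp only [comp_whiskerRight, Category.assoc]

variable [MonoidalClosed C] [HasEqualizers C]

/-- The morphism `b ⟶ Mod_b'(x, x)` corresponding to the left action on a bimodule `x`. -/
noncomputable def leftAdjunct (x : Bimod b b') :
    b.X ⟶ homObj (rightModule x) (rightModule x) :=
  homLift _ (isLinear_actLeft x)

theorem leftAdjunct_ev (x : Bimod b b') :
    x.X ◁ leftAdjunct x ≫ homEv (rightModule x) (rightModule x) =
      (β_ x.X b.X).hom ≫ x.actLeft :=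
  homLift_ev _ (isLinear_actLeft x)

theorem one_leftAdjunct (x : Bimod b b') : η[b.X] ≫ leftAdjunct x = homId (rightModule x) := by
  apply homObj_ext
  rw [homId_ev, MonoidalCategory.whiskerLeft_comp, Category.assoc]
  change x.X ◁ η[b.X] ≫ x.X ◁ leftAdjunct x ≫ _ = (ρ_ x.X).hom
  rw [leftAdjunct_ev, BraidedCategory.braiding_naturality_right_assoc, x.one_actLeft]
  simp

theorem mul_leftAdjunct (x : Bimod b b') : μ[b.X] ≫ leftAdjunct x =
    (β_ b.X b.X).hom ≫ homStar (leftAdjunct x) (leftAdjunct x) := by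
  apply homObj_ext
  rw [MonoidalCategory.whiskerLeft_comp, Category.assoc, MonoidalCategory.whiskerLeft_comp,
    Category.assoc, homStar_ev]
  change x.X ◁ μ[b.X] ≫ x.X ◁ leftAdjunct x ≫ _ =
    x.X ◁ (β_ b.X b.X).hom ≫ (α_ x.X _ _).inv ≫ (x.X ◁ leftAdjunct x ≫ _) ▷ _ ≫
      x.X ◁ leftAdjunct x ≫ _
  have h := braiding_three' x.X b.X b.X
  rw [leftAdjunct_ev, BraidedCategory.braiding_naturality_right_assoc, comp_whiskerRight,
    Category.assoc, BraidedCategory.braiding_naturality_left_assoc, x.left_assoc,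
    ← reassoc_of% h]

/-- The hom-object `Mod_b'(x, y)` from a bimodule, as a right module over `b`: an element of `b`
acts by precomposition with its left action on `x`. -/
noncomputable def homModule (x : Bimod b b') (y : RightModule b') : RightModule b where
  X := homObj (rightModule x) y
  act := (β_ _ _).hom ≫ homStar (leftAdjunct x) (𝟙 _)
  act_one := by
    have h := eId_star (C := C) (X := rightModule x) (Y := y) (𝟙 _)
    change homStar (homId (rightModule x)) (𝟙 (homObj (rightModule x) y)) = _ ≫ 𝟙 _ at h
    rw [BraidedCategory.braiding_naturality_right_assoc, ← homStar_pre_left, one_leftAdjunct, h,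
      Category.comp_id]
    exact braiding_leftUnitor _
  act_assoc := by
    have h := braiding_three' (homObj (rightModule x) y) b.X b.X
    have e : homStar (leftAdjunct x) (homStar (leftAdjunct x) (𝟙 (homObj (rightModule x) y))) =
        b.X ◁ homStar (leftAdjunct x) (𝟙 _) ≫ homStar (leftAdjunct x) (𝟙 _) := by
      rw [← homStar_pre_right, Category.comp_id]
    rw [BraidedCategory.braiding_naturality_right_assoc, ← homStar_pre_left, mul_leftAdjunct,
      homStar_pre_left, homStar_assoc, comp_whiskerRight, Category.assoc,
      BraidedCategory.braiding_naturality_left_assoc, ← e,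
      ← BraidedCategory.braiding_naturality_right_assoc, ← reassoc_of% h,
      ← MonoidalCategory.whiskerLeft_comp_assoc, SymmetricCategory.symmetry]
    simp

/-- The evaluation `x ⊗ Mod_b'(x, y) ⟶ y`, with the module `Mod_b'(x, y)` in its source. -/
noncomputable def bimodEv (x : Bimod b b') (y : RightModule b') :
    x.X ⊗ (homModule x y).X ⟶ y.X :=
  homEv (rightModule x) y

theorem bimodEv_act (x : Bimod b b') (y : RightModule b') :
    x.X ◁ (homModule x y).act ≫ bimodEv x y =
      x.X ◁ (β_ (homModule x y).X b.X).hom ≫ (α_ _ _ _).inv ≫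
        ((β_ x.X b.X).hom ≫ x.actLeft) ▷ _ ≫ bimodEv x y := by
  have h := homStar_ev (leftAdjunct x) (𝟙 (homObj (rightModule x) y))
  change x.X ◁ homStar (leftAdjunct x) (𝟙 (homObj (rightModule x) y)) ≫ _ =
    (α_ x.X _ _).inv ≫ (x.X ◁ leftAdjunct x ≫ _) ▷ _ ≫ x.X ◁ 𝟙 _ ≫ _ at h
  rw [leftAdjunct_ev, MonoidalCategory.whiskerLeft_id, Category.id_comp] at h
  change x.X ◁ ((β_ _ _).hom ≫ homStar (leftAdjunct x) (𝟙 _)) ≫ homEv (rightModule x) y = _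
  rw [MonoidalCategory.whiskerLeft_comp, Category.assoc, h]
  rfl

theorem bimodEv_whiskerRight_act (x : Bimod b b') (y : RightModule b') :
    bimodEv x y ▷ b'.X ≫ y.act =
      swap x.X (homModule x y).X b'.X ≫ x.actRight ▷ _ ≫ bimodEv x y :=
  (isLinear_homEv' (rightModule x) y).whiskerRight_act

theorem bimodEv_ext {x : Bimod b b'} {y : RightModule b'} {A : C}
    {f g : A ⟶ (homModule x y).X} (h : x.X ◁ f ≫ bimodEv x y = x.X ◁ g ≫ bimodEv x y) : f = g :=
  homObj_ext (M := rightModule x) h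

/-- The morphism into `Mod_b'(x, y)` classifying a family of morphisms of right modules. -/
noncomputable def bimodLift {x : Bimod b b'} {y : RightModule b'} {A : C} (f : x.X ⊗ A ⟶ y.X)
    (hf : IsLinear (M := rightModule x) f) : A ⟶ (homModule x y).X :=
  homLift f hf

theorem bimodLift_ev {x : Bimod b b'} {y : RightModule b'} {A : C} (f : x.X ⊗ A ⟶ y.X)
    (hf : IsLinear (M := rightModule x) f) : x.X ◁ bimodLift f hf ≫ bimodEv x y = f :=
  homLift_ev (M := rightModule x) f hf

theorem isBalanced_counit (x : Bimod b b') (y : RightModule b') :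
    IsBalanced (z := homModule x y) (x := x)
      ((ρ_ _).hom ≫ (β_ (homModule x y).X x.X).hom ≫ bimodEv x y) := by
  have h := braiding_three x.X (homModule x y).X b.X
  rw [IsBalanced, rightUnitor_naturality_assoc, rightUnitor_naturality_assoc,
    BraidedCategory.braiding_naturality_left_assoc, bimodEv_act, comp_whiskerRight,
    Category.assoc, reassoc_of% h, ← BraidedCategory.braiding_naturality_right_assoc,
    ← MonoidalCategory.whiskerLeft_comp_assoc, SymmetricCategory.symmetry,
    MonoidalCategory.whiskerLeft_id, Category.id_comp,
    ← BraidedCategory.braiding_naturality_right_assoc, Category.assoc]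

/-- If the family `F` is balanced over `b`, then its transpose `k` is linear over `b`. -/
theorem isLinear_swap_left {z : RightModule b} {x : Bimod b b'} {y : RightModule b'} {A : C}
    {F : (z.X ⊗ x.X) ⊗ A ⟶ y.X} (hF : IsBalanced F) {k : z.X ⊗ A ⟶ (homModule x y).X}
    (hk : x.X ◁ k ≫ bimodEv x y = (β_ x.X (z.X ⊗ A)).hom ≫ swap z.X A x.X ≫ F) :
    IsLinear (M := z) (N := homModule x y) k := by
  apply bimodEv_ext
  have h₁ := braiding_three' x.X (z.X ⊗ A) b.X
  have h₂ := swap_tensor_right z.X A b.X x.X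
  have h₃ := congrArg (· ▷ x.X) (swap_swap z.X b.X A)
  simp only [comp_whiskerRight, id_whiskerRight] at h₃
  rw [IsBalanced] at hF
  rw [MonoidalCategory.whiskerLeft_comp, Category.assoc, hk,
    BraidedCategory.braiding_naturality_right_assoc, ← Category.assoc (_ ▷ x.X), swap_nat_left,
    Category.assoc, hF]
  simp only [MonoidalCategory.whiskerLeft_comp, Category.assoc]
  rw [bimodEv_act, ← MonoidalCategory.whiskerLeft_comp_assoc _ (k ▷ b.X),
    BraidedCategory.braiding_naturality_left, MonoidalCategory.whiskerLeft_comp, Category.assoc,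
    associator_inv_naturality_right_assoc, whisker_exchange_assoc, hk]
  simp only [comp_whiskerRight, Category.assoc]
  rw [BraidedCategory.braiding_naturality_left_assoc, ← Category.assoc (_ ◁ x.actLeft),
    swap_nat_right, Category.assoc, reassoc_of% h₁,
    BraidedCategory.braiding_naturality_right_assoc]
  have h₄ : swap z.X A (b.X ⊗ x.X) = (α_ (z.X ⊗ A) b.X x.X).inv ≫ swap z.X A b.X ▷ x.X ≫
      swap (z.X ⊗ b.X) A x.X ≫ (α_ z.X b.X x.X).hom ▷ A := by
    rw [reassoc_of% h₂, ← comp_whiskerRight, Iso.inv_hom_id, id_whiskerRight, Category.comp_id]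
  rw [h₄]
  simp only [Category.assoc, Iso.hom_inv_id_assoc]
  rw [reassoc_of% h₃]

variable [HasCoequalizers C]

theorem isLinear_counit (x : Bimod b b') (y : RightModule b') :
    IsLinear (M := tensorModule (homModule x y) x) (N := y)
      (tensorLift _ (isBalanced_counit x y)) := by
  apply tensorModule_ext₂
  have h := swap_unit ((homModule x y).X ⊗ x.X) b'.X
  have e : (β_ (homModule x y).X x.X).hom ▷ b'.X ≫ swap x.X (homModule x y).X b'.X =
      (α_ _ _ _).hom ≫ (β_ _ _).hom := by
    rw [← braiding_swap, Category.assoc, Category.assoc, swap_swap, Category.comp_id]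
  rw [← comp_whiskerRight_assoc, tensorPr_act, ← Category.assoc (tensorPr _ x ▷ b'.X ▷ _),
    swap_nat_left, Category.assoc, ← comp_whiskerRight_assoc (tensorPr _ x ▷ _), tensorPr_lift]
  simp only [comp_whiskerRight, Category.assoc]
  rw [tensorPr_lift, reassoc_of% h, rightUnitor_naturality_assoc, rightUnitor_naturality_assoc,
    bimodEv_whiskerRight_act, reassoc_of% e, BraidedCategory.braiding_naturality_right_assoc]

/-- The counit `Mod_b'(x, y) ⊗_b x ⟶ y` of the adjunction between `- ⊗_b x` and `Mod_b'(x, -)`. -/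
noncomputable def counit (x : Bimod b b') (y : RightModule b') :
    𝟙_ C ⟶ homObj (tensorModule (homModule x y) x) y :=
  homLift _ (isLinear_counit x y)

theorem tensorPr_counit (x : Bimod b b') (y : RightModule b') :
    tensorPr (homModule x y) x ≫ pointHom (counit x y) =
      (β_ (homModule x y).X x.X).hom ≫ bimodEv x y := by
  have h := tensorPr_lift _ (isBalanced_counit x y)
  rw [pointHom, counit, homLift_ev, rightUnitor_inv_naturality_assoc, h,
    Iso.inv_hom_id_assoc]

/-- The transpose of a family of module morphisms `z ⟶ Mod_b'(x, y)`. -/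
noncomputable def homTranspose {z : RightModule b} {x : Bimod b b'} {y : RightModule b'} {A : C}
    (g : A ⟶ homObj z (homModule x y)) : A ⟶ homObj (tensorModule z x) y :=
  (ρ_ A).inv ≫ homStar (g ≫ tensorMap z (homModule x y) x) (counit x y)

/-- The transpose is the family `z ⊗ x ⟶ y` which arises from evaluating `g` at `z` and then at
`x`. -/
theorem tensorPr_homTranspose {z : RightModule b} {x : Bimod b b'} {y : RightModule b'} {A : C}
    (g : A ⟶ homObj z (homModule x y)) :
    tensorPr z x ▷ A ≫ (tensorModule z x).X ◁ homTranspose g ≫ homEv _ _ =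
      swap z.X x.X A ≫ (β_ _ _).hom ≫
        x.X ◁ (z.X ◁ g ≫ homEv z (homModule x y)) ≫ bimodEv x y := by
  have h := pointHom_right (g ≫ tensorMap z (homModule x y) x) (counit x y)
  change (tensorModule z x).X ◁ homTranspose g ≫ homEv _ _ = _ at h
  rw [h, MonoidalCategory.whiskerLeft_comp]
  simp only [Category.assoc]
  rw [← whisker_exchange_assoc]
  have h₂ := tensorPr_map z (homModule x y) x
  rw [reassoc_of% h₂, tensorPr_counit, ← Category.assoc (_ ◁ g), swap_nat_right, Category.assoc,
    ← comp_whiskerRight_assoc, BraidedCategory.braiding_naturality_left_assoc]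

theorem homTranspose_injective (z : RightModule b) (x : Bimod b b') (y : RightModule b') (A : C) :
    Function.Injective (homTranspose : (A ⟶ homObj z (homModule x y)) → _) := by
  intro g g' h
  apply homObj_ext
  apply bimodEv_ext
  have e := tensorPr_homTranspose g
  rw [h, tensorPr_homTranspose] at e
  have e' := congrArg (fun t => (β_ _ _).hom ≫ swap z.X A x.X ≫ t) e
  rw [← Category.assoc (swap z.X A x.X), swap_swap, Category.id_comp,
    SymmetricCategory.symmetry_assoc, ← Category.assoc (swap z.X A x.X), swap_swap,
    Category.id_comp, SymmetricCategory.symmetry_assoc] at e'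
  exact e'.symm

theorem homTranspose_surjective (z : RightModule b) (x : Bimod b b') (y : RightModule b') (A : C) :
    Function.Surjective (homTranspose : (A ⟶ homObj z (homModule x y)) → _) := by
  intro f
  have hlin : ((α_ z.X x.X b'.X).hom ≫ z.X ◁ x.actRight) ▷ A ≫
      tensorPr z x ▷ A ≫ (tensorModule z x).X ◁ f ≫ homEv _ _ =
        swap (z.X ⊗ x.X) b'.X A ≫
          (tensorPr z x ▷ A ≫ (tensorModule z x).X ◁ f ≫ homEv _ _) ▷ b'.X ≫ y.act := by
    have h := isLinear_homEv f
    rw [IsLinear] at h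
    rw [← comp_whiskerRight_assoc, Category.assoc, ← tensorPr_act, comp_whiskerRight,
      Category.assoc, h, comp_whiskerRight (tensorPr z x ▷ A), Category.assoc,
      ← Category.assoc (_ ▷ A), swap_nat_left, Category.assoc]
  have hbal : IsBalanced (tensorPr z x ▷ A ≫ (tensorModule z x).X ◁ f ≫ homEv _ _) := by
    rw [IsBalanced, ← comp_whiskerRight_assoc, tensorPr_condition, ← comp_whiskerRight_assoc,
      Category.assoc]
  have hk := bimodLift_ev _ (isLinear_swap_right hlin)
  refine ⟨homLift _ (isLinear_swap_left hbal hk), ?_⟩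
  apply homObj_ext
  apply tensorModule_ext
  rw [tensorPr_homTranspose, homLift_ev, hk, SymmetricCategory.symmetry_assoc,
    ← Category.assoc (swap _ _ _), swap_swap, Category.id_comp]

/-- The functor `- ⊗_b x` is cocontinuous, since it has the right adjoint `Mod_b'(x, -)`. -/
theorem isCocontinuous_tensorEnrichedFunctor (x : Bimod b b') :
    IsCocontinuous.{w} (tensorEnrichedFunctor x) :=
  isCocontinuous_of_rightAdjoint (tensorEnrichedFunctor x) (homModule x) (counit x)
    fun z y A => ⟨homTranspose_injective z x y A, homTranspose_surjective z x y A⟩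

end Adjoint

/-! ### The bimodule `b ⊗_b x` -/

section Unit

open MonoidalClosed MonObj RightModule

variable {C : Type u} [Category.{v} C] [MonoidalCategory C] [SymmetricCategory C]
  [MonoidalClosed C] [HasCoequalizers C] {b b' : Mon C}

/-- The morphism `x ⟶ b ⊗_b x` given by the unit of `b`. -/
noncomputable def toTensorRegular (x : Bimod b b') : x.X ⟶ (tensorModule (regular b) x).X :=
  (λ_ x.X).inv ≫ η[b.X] ▷ x.X ≫ tensorPr (regular b) x

theorem actLeft_toTensorRegular (x : Bimod b b') :
    x.actLeft ≫ toTensorRegular x = tensorPr (regular b) x := by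
  have h := tensorPr_condition (regular b) x
  have h' : b.X ◁ x.actLeft ≫ tensorPr (regular b) x =
      (α_ b.X b.X x.X).inv ≫ μ[b.X] ▷ x.X ≫ tensorPr (regular b) x := by
    rw [h, Iso.inv_hom_id_assoc]
  rw [toTensorRegular, leftUnitor_inv_naturality_assoc, whisker_exchange_assoc, h',
    associator_inv_naturality_left_assoc, ← comp_whiskerRight_assoc (η[b.X] ▷ _), MonObj.one_mul]
  simp

/-- The morphism `b ⊗_b x ⟶ x` induced by the left action. -/
noncomputable def fromTensorRegular (x : Bimod b b') : (tensorModule (regular b) x).X ⟶ x.X :=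
  coequalizer.desc x.actLeft ((x.left_assoc).trans (Category.assoc _ _ _).symm)

theorem tensorPr_fromTensorRegular (x : Bimod b b') :
    tensorPr (regular b) x ≫ fromTensorRegular x = x.actLeft :=
  coequalizer.π_desc _ _

/-- The isomorphism `x ≅ b ⊗_b x` in `C`. -/
noncomputable def isoTensorRegular (x : Bimod b b') :
    x.X ≅ (tensorModule (regular b) x).X where
  hom := toTensorRegular x
  inv := fromTensorRegular x
  hom_inv_id := by
    rw [toTensorRegular, Category.assoc, Category.assoc, tensorPr_fromTensorRegular,
      x.one_actLeft, Iso.inv_hom_id]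
  inv_hom_id := by
    have h : tensorPr (regular b) x ≫ fromTensorRegular x ≫ toTensorRegular x =
        tensorPr (regular b) x ≫ 𝟙 _ := by
      rw [← Category.assoc, tensorPr_fromTensorRegular, actLeft_toTensorRegular,
        Category.comp_id]
    exact coequalizer.hom_ext h

theorem toTensorRegular_act (x : Bimod b b') :
    x.actRight ≫ toTensorRegular x =
      toTensorRegular x ▷ b'.X ≫ (tensorModule (regular b) x).act := by
  rw [toTensorRegular, comp_whiskerRight, comp_whiskerRight, Category.assoc, Category.assoc,
    tensorPr_act, associator_naturality_left_assoc, ← whisker_exchange_assoc,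
    leftUnitor_inv_naturality_assoc]
  simp

variable [HasEqualizers C]

/-- The left action on `b ⊗_b x`, regarded as the value of `- ⊗_b x` at the regular module, is
induced by left multiplication on the factor `b`. -/
theorem tensorPr_evalAct (x : Bimod b b') :
    b.X ◁ tensorPr (regular b) x ≫ evalAct (tensorEnrichedFunctor x) =
      (α_ b.X b.X x.X).inv ≫ μ[b.X] ▷ x.X ≫ tensorPr (regular b) x := by
  have h := tensorPr_map (regular b) (regular b) x
  have h₂ : tensorPr (regular b) x ▷ b.X ≫ (tensorModule (regular b) x).X ◁
      (leftMul b ≫ tensorMap (regular b) (regular b) x) ≫ homEv _ _ =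
        swap b.X x.X b.X ≫ ((β_ b.X b.X).hom ≫ μ[b.X]) ▷ x.X ≫ tensorPr (regular b) x := by
    rw [MonoidalCategory.whiskerLeft_comp, Category.assoc, ← whisker_exchange_assoc, h,
      ← Category.assoc (_ ◁ leftMul b), swap_nat_right, Category.assoc, ← comp_whiskerRight_assoc]
    exact congrArg (fun t => swap b.X x.X b.X ≫ t ▷ x.X ≫ tensorPr (regular b) x) (leftMul_ev b)
  have h₃ : (β_ b.X (b.X ⊗ x.X)).hom ≫ swap b.X x.X b.X ≫ (β_ b.X b.X).hom ▷ x.X =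
      (α_ b.X b.X x.X).inv := by
    have e := braiding_swap b.X x.X b.X
    rw [← cancel_epi (α_ b.X b.X x.X).hom, reassoc_of% e, ← comp_whiskerRight,
      SymmetricCategory.symmetry]
    simp
  change b.X ◁ tensorPr (regular b) x ≫ (β_ _ _).hom ≫ (tensorModule (regular b) x).X ◁
    (leftMul b ≫ tensorMap (regular b) (regular b) x) ≫ homEv _ _ = _
  rw [BraidedCategory.braiding_naturality_right_assoc]
  refine (congrArg (fun t => (β_ b.X (b.X ⊗ x.X)).hom ≫ t) h₂).trans ?_
  rw [comp_whiskerRight, Category.assoc, reassoc_of% h₃]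

theorem toTensorRegular_evalAct (x : Bimod b b') :
    x.actLeft ≫ toTensorRegular x =
      b.X ◁ toTensorRegular x ≫ evalAct (tensorEnrichedFunctor x) := by
  have h : b.X ◁ toTensorRegular x =
      (b.X ◁ ((λ_ x.X).inv ≫ η[b.X] ▷ x.X)) ≫ b.X ◁ tensorPr (regular b) x := by
    rw [toTensorRegular, ← MonoidalCategory.whiskerLeft_comp, Category.assoc]
  rw [actLeft_toTensorRegular, h]
  refine Eq.trans ?_ (Category.assoc _ _ _).symm
  refine Eq.trans ?_ (congrArg (fun t => _ ≫ t) (tensorPr_evalAct x).symm)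
  rw [MonoidalCategory.whiskerLeft_comp, Category.assoc, associator_inv_naturality_middle_assoc,
    ← comp_whiskerRight_assoc, MonObj.mul_one]
  simp

/-- The isomorphism of bimodules `x ≅ b ⊗_b x`. -/
noncomputable def bimodIso (x : Bimod b b') : x ≅ evalBimod (tensorEnrichedFunctor x) :=
  Bimod.isoOfIso (Q := evalBimod (tensorEnrichedFunctor x)) (isoTensorRegular x)
    (toTensorRegular_evalAct x) (toTensorRegular_act x)

theorem toTensorRegular_naturality {x x' : Bimod b b'} (g : x ⟶ x') :
    g.hom ≫ toTensorRegular x' =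
      toTensorRegular x ≫ pointHom (tensorTransApp (regular b) g) := by
  have h := tensorPr_transApp (regular b) g
  have h₂ : tensorPr (regular b) x ≫ pointHom (tensorTransApp (regular b) g) =
      b.X ◁ g.hom ≫ tensorPr (regular b) x' := by
    rw [pointHom, rightUnitor_inv_naturality_assoc, h, Iso.inv_hom_id_assoc]
  rw [toTensorRegular, toTensorRegular, Category.assoc, Category.assoc, h₂,
    leftUnitor_inv_naturality_assoc, whisker_exchange_assoc]

/-- The isomorphism `x ≅ b ⊗_b x` is natural in the bimodule `x`. -/
noncomputable def tensorEvalIso (b b' : Mon C) :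
    𝟭 (Bimod b b') ≅ tensorFunctor b b' ⋙ evalFunctor b b' :=
  NatIso.ofComponents bimodIso fun g => Bimod.hom_ext _ _ (toTensorRegular_naturality g)

end Unit

/-! ### Evaluation at the regular module is fully faithful -/

section FullyFaithful

open MonoidalClosed MonObj RightModule

variable {C : Type u} [Category.{v} C] [MonoidalCategory C] [SymmetricCategory C]
  [MonoidalClosed C] [HasEqualizers C] {b b' : Mon C}

theorem pointHom_injective {M N : RightModule b'} {f g : 𝟙_ C ⟶ homObj M N}
    (h : pointHom f = pointHom g) : f = g := by
  apply homObj_ext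
  rw [whiskerLeft_ev_unit, whiskerLeft_ev_unit, h]

theorem exists_pointHom {M N : RightModule b'} (f : M.X ⟶ N.X)
    (hf : M.act ≫ f = f ▷ b'.X ≫ N.act) : ∃ g : 𝟙_ C ⟶ homObj M N, pointHom g = f := by
  have h : IsLinear (M := M) (N := N) ((ρ_ M.X).hom ≫ f) := by
    have e := swap_unit M.X b'.X
    rw [IsLinear, rightUnitor_naturality_assoc, hf, comp_whiskerRight, Category.assoc,
      reassoc_of% e]
  refine ⟨homLift _ h, ?_⟩
  rw [pointHom, homLift_ev, Iso.inv_hom_id_assoc]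

/-- A module morphism `F(b_b) ⟶ G(b_b)` which commutes with the left actions of `b` commutes with
the actions of all of `Mod_b(b_b, b_b)`, which is isomorphic to `b`. -/
theorem star_map_regular {F G : EnrichedFunctor C (RightModule b) (RightModule b')}
    {g : 𝟙_ C ⟶ homObj (F.obj (regular b)) (G.obj (regular b))}
    (hg : evalAct F ≫ pointHom g = b.X ◁ pointHom g ≫ evalAct G) :
    homStar g (G.map (regular b) (regular b)) =
      (λ_ (homObj (regular b) (regular b))).hom ≫ (ρ_ (homObj (regular b) (regular b))).inv ≫
        homStar (F.map (regular b) (regular b)) g := by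
  have h : (λ_ b.X).inv ≫ homStar g (evalAdjunct G) =
      (ρ_ b.X).inv ≫ homStar (evalAdjunct F) g := by
    apply homObj_ext
    refine (pointHom_left g (evalAdjunct G)).trans
      (Eq.trans ?_ (pointHom_right (evalAdjunct F) g).symm)
    rw [evalAct, evalAct, BraidedCategory.braiding_naturality_right_assoc, Category.assoc,
      cancel_epi] at hg
    exact hg.symm
  have e : ∀ H : EnrichedFunctor C (RightModule b) (RightModule b'),
      H.map (regular b) (regular b) = evOne (regular b) ≫ evalAdjunct H := by
    intro H
    have h₁ : evOne (regular b) ≫ leftMul b = 𝟙 _ := evOne_ofElement (regular b)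
    rw [evalAdjunct, ← Category.assoc, h₁]
    exact (Category.id_comp _).symm
  have hG : homStar g (G.map (regular b) (regular b)) =
      _ ◁ evOne (regular b) ≫ homStar g (evalAdjunct G) := by
    rw [← homStar_pre_right, ← e]
  have hF : homStar (F.map (regular b) (regular b)) g =
      evOne (regular b) ▷ _ ≫ homStar (evalAdjunct F) g := by
    rw [← homStar_pre_left, ← e]
  have h' : homStar g (evalAdjunct G) = (λ_ b.X).hom ≫ (ρ_ b.X).inv ≫
      homStar (evalAdjunct F) g := by
    rw [← h, Iso.hom_inv_id_assoc]
  rw [hG, hF, h']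
  simp

theorem evalHom_bijective {F : EnrichedFunctor C (RightModule b) (RightModule b')}
    (hF : IsLanFrom F (regular b)) (G : EnrichedFunctor C (RightModule b) (RightModule b')) :
    Function.Bijective (evalHom : EnrichedTrans F G → _) := by
  constructor
  · intro ξ ζ h
    exact hF.trans_ext (pointHom_injective (congrArg Bimod.Hom.hom h))
  · intro g
    obtain ⟨t, ht⟩ := exists_pointHom (M := F.obj (regular b)) (N := G.obj (regular b)) g.hom
      g.right_act_hom
    have hl : evalAct F ≫ pointHom t = b.X ◁ pointHom t ≫ evalAct G := by
      rw [ht]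
      exact g.left_act_hom
    obtain ⟨ξ, hξ⟩ := hF.exists_trans t (star_map_regular hl)
    refine ⟨ξ, Bimod.hom_ext _ _ ?_⟩
    change pointHom (ξ.app (regular b)) = g.hom
    rw [hξ, ht]

/-- Evaluation at the regular module, on cocontinuous functors. -/
noncomputable abbrev coconEval (b b' : Mon C) :
    CoconFunct.{w} C (RightModule b) (RightModule b') ⥤ Bimod b b' :=
  coconInclusion C _ _ ⋙ evalFunctor b b'

theorem coconEval_faithful (b b' : Mon C) : (coconEval.{w} b b').Faithful where
  map_injective {F _} _ _ h := ObjectProperty.hom_ext _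
    ((evalHom_bijective (F.property.isLanFrom (isLanFrom_id_regular b)) _).1 h)

theorem coconEval_full (b b' : Mon C) : (coconEval.{w} b b').Full where
  map_surjective {F _} g := by
    obtain ⟨ξ, hξ⟩ :=
      (evalHom_bijective (F.property.isLanFrom (isLanFrom_id_regular b)) _).2 g
    exact ⟨ObjectProperty.homMk ξ, hξ⟩

variable [HasCoequalizers C]

/-- The functor `x ↦ - ⊗_b x`, with values in cocontinuous functors. -/
noncomputable def coconTensor (b b' : Mon C) :
    Bimod b b' ⥤ CoconFunct.{w} C (RightModule b) (RightModule b') :=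
  ObjectProperty.lift _ (tensorFunctor b b') isCocontinuous_tensorEnrichedFunctor

/-- The isomorphism `x ≅ b ⊗_b x`, for the functors restricted to cocontinuous functors. -/
noncomputable def coconTensorEvalIso (b b' : Mon C) :
    𝟭 (Bimod b b') ≅ coconTensor.{w} b b' ⋙ coconEval b b' :=
  tensorEvalIso b b'

theorem coconEval_isEquivalence (b b' : Mon C) : (coconEval.{w} b b').IsEquivalence where
  faithful := coconEval_faithful b b'
  full := coconEval_full b b'
  essSurj := ⟨fun x => ⟨_, ⟨((coconTensorEvalIso b b').app x).symm⟩⟩⟩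

end FullyFaithful

end EnrichedEW

theorem corollary1p2 {C : Type u} [Category.{v} C] [MonoidalCategory C]
    [SymmetricCategory C] [MonoidalClosed C] [HasFiniteLimits C] [HasFiniteColimits C]
    (b b' : Mon C) :
    ∃ e : Bimod b b' ≌
        EnrichedEW.CoconFunct.{w} C (EnrichedEW.RightModule b) (EnrichedEW.RightModule b'),
      e.functor ⋙ EnrichedEW.coconInclusion.{w} C _ _ = EnrichedEW.tensorFunctor b b' ∧
      e.inverse = EnrichedEW.coconInclusion.{w} C _ _ ⋙ EnrichedEW.evalFunctor b b' := by
  have := EnrichedEW.coconEval_isEquivalence.{w} b b'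
  -- The composite `R⁻¹ ≅ (L ⋙ R) ⋙ R⁻¹ ≅ L`, for `L` the tensor functor and `R` evaluation.
  let i : (EnrichedEW.coconEval.{w} b b').inv ≅ EnrichedEW.coconTensor b b' :=
    (Functor.leftUnitor _).symm ≪≫
      Functor.isoWhiskerRight (EnrichedEW.coconTensorEvalIso b b') _ ≪≫ Functor.associator _ _ _ ≪≫
      Functor.isoWhiskerLeft _ (EnrichedEW.coconEval b b').asEquivalence.unitIso.symm ≪≫
      Functor.rightUnitor _
  exact ⟨(EnrichedEW.coconEval b b').asEquivalence.symm.changeFunctor i, rfl, rfl⟩
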